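/- **Theorem 2.2 (weak comparison principle).** Let $n\ge 1$, let $\Omega\subset\mathbb R^n$ be a bounded open set, let $\beta>1$, and let $f\in L^1(\Omega)$ satisfy $f\ge 0$ a.e. in $\Omega$. Consider the problem $$-\Delta u=\frac{f}{u^\beta}\ \text{ in }\Omega,\qquad u>0\ \text{ in }\Omega, \tag{P}$$ where $u>0$ in $\Omega$ means that $\operatorname{ess\,inf}_K u>0$ for every compact set $K\subset\Omega$. A function $u\in H^1_{loc}(\Omega)$ with $u>0$ in $\Omega$ in this sense is called a subsolution of (P) if $$\int_\Omega \nabla u\cdot\nabla\varphi\,dx\le\int_\Omega\frac{f}{u^\beta}\,\varphi\,dx\qquad\text{for all }\varphi\in C^1_c(\Omega)\text{ with }\varphi\ge 0,$$ and a supersolution of (P) if the reverse inequality $\ge$ holds for all such $\varphi$. We say that $u\le 0$ on $\partial\Omega$ if $(u-\varepsilon)^+\in H^1_0(\Omega)$ for every $\varepsilon>0$, where $H^1_0(\Omega)$ is the closure of $C^\infty_c(\Omega)$ in $H^1(\Omega)$. Let $u\in H^1_{loc}(\Omega)$ be a subsolution of (P) such that $u\le 0$ on $\partial\Omega$, and let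 $v\in H^1_{loc}(\Omega)$ be a supersolution of (P). Then $u\le v$ a.e. in $\Omega$. -/

import Mathlib

open MeasureTheory Filter Topology
open scoped ContDiff

namespace SingularElliptic

/-- `φ ∈ C^k_c(Ω)`: a function of class `C^k` on `ℝⁿ` whose (closed) support is a compact
subset of `Ω`. -/
def IsTestFunction {n : ℕ} (k : WithTop ℕ∞) (Ω : Set (EuclideanSpace ℝ (Fin n)))
    (φ : EuclideanSpace ℝ (Fin n) → ℝ) : Prop :=
  ContDiff ℝ k φ ∧ HasCompactSupport φ ∧ tsupport φ ⊆ Ω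

/-- `G` is the weak (distributional) gradient of `u` in `Ω`:
`∫_Ω u ∇φ = - ∫_Ω φ G` (an identity of vectors) for every `φ ∈ C^∞_c(Ω)`. -/
def HasWeakGradient {n : ℕ} (Ω : Set (EuclideanSpace ℝ (Fin n)))
    (u : EuclideanSpace ℝ (Fin n) → ℝ)
    (G : EuclideanSpace ℝ (Fin n) → EuclideanSpace ℝ (Fin n)) : Prop :=
  LocallyIntegrableOn u Ω ∧ LocallyIntegrableOn G Ω ∧
    ∀ φ : EuclideanSpace ℝ (Fin n) → ℝ, IsTestFunction ∞ Ω φ →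
      ∫ x in Ω, u x • gradient φ x = -∫ x in Ω, φ x • G x

/-- `u ∈ H^1_loc(Ω)` with weak gradient `G`: both `u` and `G` are square integrable on every
compact subset of `Ω`. -/
def IsH1locWithGradient {n : ℕ} (Ω : Set (EuclideanSpace ℝ (Fin n)))
    (u : EuclideanSpace ℝ (Fin n) → ℝ)
    (G : EuclideanSpace ℝ (Fin n) → EuclideanSpace ℝ (Fin n)) : Prop :=
  HasWeakGradient Ω u G ∧
    ∀ K : Set (EuclideanSpace ℝ (Fin n)), IsCompact K → K ⊆ Ω →
      MemLp u 2 (volume.restrict K) ∧ MemLp G 2 (volume.restrict K)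

/-- `u ∈ H^1_0(Ω)`: `u` lies in `H^1(Ω)` and is the limit, in the norm of `H^1(Ω)`, of a sequence
of functions in `C^∞_c(Ω)`. -/
def MemH10 {n : ℕ} (Ω : Set (EuclideanSpace ℝ (Fin n)))
    (u : EuclideanSpace ℝ (Fin n) → ℝ) : Prop :=
  ∃ G : EuclideanSpace ℝ (Fin n) → EuclideanSpace ℝ (Fin n),
    HasWeakGradient Ω u G ∧
    MemLp u 2 (volume.restrict Ω) ∧ MemLp G 2 (volume.restrict Ω) ∧
    ∃ φ : ℕ → EuclideanSpace ℝ (Fin n) → ℝ,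
      (∀ m, IsTestFunction ∞ Ω (φ m)) ∧
      Tendsto (fun m => eLpNorm (fun x => φ m x - u x) 2 (volume.restrict Ω)) atTop (𝓝 0) ∧
      Tendsto (fun m => eLpNorm (fun x => gradient (φ m) x - G x) 2 (volume.restrict Ω))
        atTop (𝓝 0)

/-- `u > 0` in `Ω`: the essential infimum of `u` on every compact subset of `Ω` is positive. -/
def LocallyEssPos {n : ℕ} (Ω : Set (EuclideanSpace ℝ (Fin n)))
    (u : EuclideanSpace ℝ (Fin n) → ℝ) : Prop :=
  ∀ K : Set (EuclideanSpace ℝ (Fin n)), IsCompact K → K ⊆ Ω →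
    ∃ c : ℝ, 0 < c ∧ ∀ᵐ x ∂(volume.restrict K), c ≤ u x

/-- `u ≤ 0` on `∂Ω`: `(u - ε)⁺ ∈ H^1_0(Ω)` for every `ε > 0`. -/
def NonposOnBoundary {n : ℕ} (Ω : Set (EuclideanSpace ℝ (Fin n)))
    (u : EuclideanSpace ℝ (Fin n) → ℝ) : Prop :=
  ∀ ε : ℝ, 0 < ε → MemH10 Ω (fun x => max (u x - ε) 0)

/-- `u ∈ H^1_loc(Ω)` is a weak subsolution of `-Δu = f / u^β`, `u > 0`, in `Ω`. -/
def IsSubsolution {n : ℕ} (Ω : Set (EuclideanSpace ℝ (Fin n))) (β : ℝ)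
    (f u : EuclideanSpace ℝ (Fin n) → ℝ) : Prop :=
  LocallyEssPos Ω u ∧
  ∃ G : EuclideanSpace ℝ (Fin n) → EuclideanSpace ℝ (Fin n),
    IsH1locWithGradient Ω u G ∧
    ∀ φ : EuclideanSpace ℝ (Fin n) → ℝ, IsTestFunction 1 Ω φ → (∀ x, 0 ≤ φ x) →
      ∫ x in Ω, inner ℝ (G x) (gradient φ x) ≤ ∫ x in Ω, f x / (u x) ^ β * φ x

/-- `v ∈ H^1_loc(Ω)` is a weak supersolution of `-Δv = f / v^β`, `v > 0`, in `Ω`. -/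
def IsSupersolution {n : ℕ} (Ω : Set (EuclideanSpace ℝ (Fin n))) (β : ℝ)
    (f v : EuclideanSpace ℝ (Fin n) → ℝ) : Prop :=
  LocallyEssPos Ω v ∧
  ∃ G : EuclideanSpace ℝ (Fin n) → EuclideanSpace ℝ (Fin n),
    IsH1locWithGradient Ω v G ∧
    ∀ φ : EuclideanSpace ℝ (Fin n) → ℝ, IsTestFunction 1 Ω φ → (∀ x, 0 ≤ φ x) →
      ∫ x in Ω, f x / (v x) ^ β * φ x ≤ ∫ x in Ω, inner ℝ (G x) (gradient φ x)

end SingularElliptic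

/-! Formally one tests the difference of the two inequalities with a function of `u - v` supported
in `{u - v > 2ε}`. There `f / u ^ β ≤ f / v ^ β`, since `f ≥ 0` and `u ≥ v > 0`, so the gradient
energy of `u - v` on this set cannot be positive. The difficulty is at the boundary: `v` lies only
in `H^1_loc` and has no prescribed boundary behaviour, so this function need not be an admissible
test function.

The remedy is that `v` is superharmonic. Testing its inequality with `φ² / v` gives `‖(φ / v) ∇v‖ ≤
2 ‖∇φ‖` in `L²` (`eLpNorm_div_smul_le_of_superharmonic`), and Fatou's lemma yields `(z / v) ∇v ∈
L²(Ω)` for `z = (u - ε)⁺ ∈ H^1_0` (`memLp_div_smul_of_superharmonic`). Where `u - v > 2ε` one has `z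
> v`, hence `∇v` is square integrable there. So is `∇u`, which agrees with `∇z` there
(`IsH1locWithGradient.ae_eq_of_posPart`).

Cutoffs come from the same `z`: if `φ_m → z` with `φ_m` smooth and compactly supported, then `q
(φ_m)`, for a smooth step `q` between `ε / 2` and `ε`, is compactly supported and eventually equal
to `1` at almost every point of `{u - v > 2ε}`, because `z > ε` there. Testing with `p (u - v) q
(φ_m)` (`integral_comp_sub_test_le`), the cutoff error tends to zero, and the limit is `∫ p' (u - v)
|∇(u - v)|² ≤ 0` (`ae_sub_le_two_mul`). Thus `p (u - v)` has zero weak gradient. Testing this with a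
coordinate times the same cutoff gives `∫ p (u - v) = 0`, that is `u - v ≤ 2ε`.

All nonlinear test functions and chain rules are justified by mollification on a compact set
(`IsH1locWithGradient.exists_smooth_approx`) and the limit lemma `tendsto_integral_mul_inner`. -/

namespace SingularElliptic

/-! ### Limits of weighted `L²` pairings. -/

section Pairing

variable {α F : Type*} [MeasurableSpace α] {μ : Measure α}
  [NormedAddCommGroup F] [InnerProductSpace ℝ F]

theorem integrable_inner_of_memLp {X Y : α → F} (hX : MemLp X 2 μ) (hY : MemLp Y 2 μ) :
    Integrable (fun x => inner ℝ (X x) (Y x)) μ :=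
  (hX.norm.integrable_mul hY.norm).mono' (hX.1.inner hY.1)
    (ae_of_all _ fun x => norm_inner_le_norm (𝕜 := ℝ) (X x) (Y x))

theorem integrable_mul_inner {b : α → ℝ} {C : ℝ} {X Y : α → F}
    (hbm : AEStronglyMeasurable b μ) (hb : ∀ᵐ x ∂μ, |b x| ≤ C)
    (hX : MemLp X 2 μ) (hY : MemLp Y 2 μ) :
    Integrable (fun x => b x * inner ℝ (X x) (Y x)) μ :=
  (integrable_inner_of_memLp hX hY).bdd_mul hbm hb

/-- Passage to the limit in `∫ bₖ ⟪X, Yₖ⟫` for bounded coefficients converging a.e. and vector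
fields converging in `L²`. -/
theorem tendsto_integral_mul_inner {b : ℕ → α → ℝ} {b₀ : α → ℝ} {C : ℝ} {X : α → F}
    {Y : ℕ → α → F} {Y₀ : α → F}
    (hbm : ∀ k, AEStronglyMeasurable (b k) μ) (hb : ∀ k, ∀ᵐ x ∂μ, |b k x| ≤ C)
    (hlim : ∀ᵐ x ∂μ, Tendsto (fun k => b k x) atTop (𝓝 (b₀ x)))
    (hX : MemLp X 2 μ) (hY : ∀ k, MemLp (Y k) 2 μ) (hY₀ : MemLp Y₀ 2 μ)
    (hYlim : Tendsto (fun k => eLpNorm (fun x => Y k x - Y₀ x) 2 μ) atTop (𝓝 0)) :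
    Tendsto (fun k => ∫ x, b k x * inner ℝ (X x) (Y k x) ∂μ) atTop
      (𝓝 (∫ x, b₀ x * inner ℝ (X x) (Y₀ x) ∂μ)) := by
  -- Split `Yₖ = Y₀ + (Yₖ - Y₀)`: dominated convergence handles the fixed field, and Cauchy–Schwarz
  -- with the uniform bound on `bₖ` handles the remainder.
  have h1 : Tendsto (fun k => ∫ x, b k x * inner ℝ (X x) (Y₀ x) ∂μ) atTop
      (𝓝 (∫ x, b₀ x * inner ℝ (X x) (Y₀ x) ∂μ)) := by
    have hint : Integrable (fun x => inner ℝ (X x) (Y₀ x)) μ := integrable_inner_of_memLp hX hY₀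
    refine tendsto_integral_of_dominated_convergence (fun x => C * ‖inner ℝ (X x) (Y₀ x)‖)
      (fun k => (hbm k).mul hint.aestronglyMeasurable) (hint.norm.const_mul C) ?_ ?_
    · intro k
      filter_upwards [hb k] with x hx
      rw [norm_mul]
      exact mul_le_mul_of_nonneg_right hx (norm_nonneg _)
    · filter_upwards [hlim] with x hx using hx.mul_const _
  have h2 : Tendsto (fun k => ∫ x, b k x * inner ℝ (X x) (Y k x - Y₀ x) ∂μ) atTop (𝓝 0) := by
    have hle : ∀ k, ‖∫ x, b k x * inner ℝ (X x) (Y k x - Y₀ x) ∂μ‖ₑ ≤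
        ENNReal.ofReal C * eLpNorm X 2 μ * eLpNorm (fun x => Y k x - Y₀ x) 2 μ := by
      intro k
      refine (enorm_integral_le_lintegral_enorm _).trans ?_
      rw [← eLpNorm_one_eq_lintegral_enorm]
      have hb' := (eLpNorm_le_eLpNorm_mul_eLpNorm'_of_norm (μ := μ) (p := 2) (q := 2) (r := 1)
        (f := fun x => b k x • X x)
        ((hbm k).smul hX.1) ((hY k).sub hY₀).1 (fun a c => inner ℝ a c) 1
        (ae_of_all _ fun x => by simpa using norm_inner_le_norm (𝕜 := ℝ) _ _))
      simp only [real_inner_smul_left, Pi.sub_apply] at hb'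
      refine hb'.trans ?_
      rw [ENNReal.coe_one, one_mul]
      refine mul_le_mul_left ?_ _
      refine eLpNorm_le_mul_eLpNorm_of_ae_le_mul (c := C) ?_ 2
      filter_upwards [hb k] with x hx
      rw [norm_smul]
      exact mul_le_mul_of_nonneg_right hx (norm_nonneg _)
    rw [tendsto_zero_iff_enorm_tendsto_zero]
    refine tendsto_of_tendsto_of_tendsto_of_le_of_le tendsto_const_nhds ?_ (fun _ => zero_le) hle
    have := ENNReal.Tendsto.const_mul (a := ENNReal.ofReal C * eLpNorm X 2 μ) hYlim
      (Or.inr (ENNReal.mul_ne_top ENNReal.ofReal_ne_top hX.2.ne))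
    simpa using this
  have h3 := h2.add h1
  rw [zero_add] at h3
  refine h3.congr fun k => ?_
  have hs : ∀ x, b k x * inner ℝ (X x) (Y k x - Y₀ x) =
      b k x * inner ℝ (X x) (Y k x) - b k x * inner ℝ (X x) (Y₀ x) := by
    intro x; rw [inner_sub_right, mul_sub]
  simp_rw [hs]
  rw [integral_sub (integrable_mul_inner (hbm k) (hb k) hX (hY k))
    (integrable_mul_inner (hbm k) (hb k) hX hY₀), sub_add_cancel]

end Pairing

/-! ### Mollification in `L²`. -/

section Mollification

variable {E F : Type*} [NormedAddCommGroup E] [NormedSpace ℝ E] [FiniteDimensional ℝ E]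
  [MeasurableSpace E] [BorelSpace E] {μ : Measure E} [μ.IsAddHaarMeasure]
  [NormedAddCommGroup F] [NormedSpace ℝ F]

/-- Convolution with a normed bump function is a contraction of `L²`. -/
theorem eLpNorm_two_normed_convolution_le (φ : ContDiffBump (0 : E)) {g : E → F}
    (hg : AEStronglyMeasurable g μ) :
    eLpNorm (convolution (φ.normed μ) g (ContinuousLinearMap.lsmul ℝ ℝ) μ) 2 μ ≤
      eLpNorm g 2 μ := by
  set ρ := φ.normed μ with hρ
  have hρc : Continuous ρ := φ.continuous_normed
  -- The kernel has mass one, so the convolution is an average against a probability measure. The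
  -- `L¹` norm is then at most the `L²` norm pointwise in `x`; Tonelli and translation invariance
  -- finish the estimate.
  set ν := μ.withDensity (fun t => ‖ρ t‖ₑ) with hν
  have hρm : Measurable fun t => ‖ρ t‖ₑ := hρc.measurable.enorm
  have hprob : IsProbabilityMeasure ν := by
    constructor
    rw [hν, withDensity_apply _ MeasurableSet.univ, Measure.restrict_univ,
      ← ofReal_integral_norm_eq_lintegral_enorm φ.integrable_normed]
    simp only [Real.norm_of_nonneg (φ.nonneg_normed (μ := μ) _)]
    rw [φ.integral_normed, ENNReal.ofReal_one]
  have hac : ν ≪ μ := withDensity_absolutelyContinuous _ _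
  have hpt : ∀ x, ‖convolution ρ g (ContinuousLinearMap.lsmul ℝ ℝ) μ x‖ₑ ^ (2 : ℝ) ≤
      ∫⁻ t, ‖g (x - t)‖ₑ ^ (2 : ℝ) ∂ν := by
    intro x
    have hgx : AEStronglyMeasurable (fun t => g (x - t)) ν :=
      (hg.comp_quasiMeasurePreserving (quasiMeasurePreserving_sub_left μ x)).mono_ac hac
    have e1 : ‖convolution ρ g (ContinuousLinearMap.lsmul ℝ ℝ) μ x‖ₑ ≤
        eLpNorm (fun t => g (x - t)) 1 ν := by
      rw [eLpNorm_one_eq_lintegral_enorm, hν, lintegral_withDensity_eq_lintegral_mul_non_measurable₀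
        _ hρm.aemeasurable (ae_of_all _ fun t => enorm_lt_top)]
      refine (enorm_integral_le_lintegral_enorm _).trans (lintegral_mono fun t => ?_)
      simp [enorm_smul]
    have e2 := e1.trans (eLpNorm_le_eLpNorm_of_exponent_le (p := 1) (q := 2) (by norm_num) hgx)
    rw [eLpNorm_eq_lintegral_rpow_enorm_toReal (by norm_num) (by norm_num)] at e2
    have e3 := ENNReal.rpow_le_rpow e2 (z := 2) (by norm_num)
    rw [← ENNReal.rpow_mul] at e3
    simpa using e3
  rw [eLpNorm_eq_lintegral_rpow_enorm_toReal (by norm_num) (by norm_num),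
    eLpNorm_eq_lintegral_rpow_enorm_toReal (by norm_num) (by norm_num)]
  refine ENNReal.rpow_le_rpow ?_ (by simp)
  simp only [ENNReal.toReal_ofNat]
  refine (lintegral_mono hpt).trans ?_
  have hmeas : AEStronglyMeasurable (fun p : E × E => g (p.1 - p.2)) (μ.prod ν) :=
    hg.comp_quasiMeasurePreserving (quasiMeasurePreserving_sub μ ν)
  rw [lintegral_lintegral_swap (hmeas.enorm.pow_const 2)]
  have : ∀ t, ∫⁻ x, ‖g (x - t)‖ₑ ^ (2 : ℝ) ∂μ = ∫⁻ x, ‖g x‖ₑ ^ (2 : ℝ) ∂μ := fun t =>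
    lintegral_sub_right_eq_self (fun x => ‖g x‖ₑ ^ (2 : ℝ)) t
  simp_rw [this]
  simp

/-- Mollifications of an `L²` function converge to it in `L²` on compact sets. -/
theorem tendsto_eLpNorm_normed_convolution_sub [CompleteSpace F] {φ : ℕ → ContDiffBump (0 : E)} {g : E → F}
    (hφ : Tendsto (fun k => (φ k).rOut) atTop (𝓝 0)) (hg : MemLp g 2 μ)
    {K : Set E} (hK : IsCompact K) :
    Tendsto (fun k => eLpNorm (fun x =>
      convolution ((φ k).normed μ) g (ContinuousLinearMap.lsmul ℝ ℝ) μ x - g x) 2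
      (μ.restrict K)) atTop (𝓝 0) := by
  have hKfin : IsFiniteMeasure (μ.restrict K) := isFiniteMeasure_restrict.2 hK.measure_lt_top.ne
  rw [ENNReal.tendsto_atTop_zero]
  intro ε hε
  rcases eq_or_ne ε ⊤ with rfl | hεt
  · exact ⟨0, fun _ _ => le_top⟩
  have hε3 : ε / 3 ≠ 0 := (ENNReal.div_pos hε.ne' (by norm_num)).ne'
  -- An `ε / 3` argument: `g - h` is small, stays small under the contraction, and `h` is uniformly
  -- continuous.
  obtain ⟨h, hhc, hgh, hcont, hhL⟩ := hg.exists_hasCompactSupport_eLpNorm_sub_le (by norm_num) hε3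
  -- uniform convergence for the continuous function
  set M := (μ.restrict K Set.univ) ^ (1 / (2 : ℝ)) with hM
  have hMfin : M ≠ ⊤ := ENNReal.rpow_ne_top_of_nonneg (by norm_num) (measure_ne_top _ _)
  -- Dividing by `M + 1` rather than `M` covers a null set `K`.
  obtain ⟨δ, hδ, hδM⟩ : ∃ δ : ℝ, 0 < δ ∧ M * ENNReal.ofReal δ ≤ ε / 3 := by
    have hne : ε / 3 / (M + 1) ≠ ⊤ :=
      (ENNReal.div_lt_top (ENNReal.div_lt_top hεt (by norm_num)).ne (by simp)).ne
    refine ⟨(ε / 3 / (M + 1)).toReal, ENNReal.toReal_pos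
      (ENNReal.div_pos hε3 (by simp [hMfin])).ne' hne, ?_⟩
    rw [ENNReal.ofReal_toReal hne]
    calc M * (ε / 3 / (M + 1)) ≤ (M + 1) * (ε / 3 / (M + 1)) := by gcongr; exact le_self_add
      _ ≤ ε / 3 := ENNReal.mul_div_le
  obtain ⟨η, hη, hηu⟩ := Metric.uniformContinuous_iff.1
    (hhc.uniformContinuous_of_continuous hcont) δ hδ
  obtain ⟨N, hN⟩ := eventually_atTop.1 (hφ.eventually (gt_mem_nhds hη))
  refine ⟨N, fun k hk => ?_⟩
  set T : (E → F) → E → F := fun g =>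
    convolution ((φ k).normed μ) g (ContinuousLinearMap.lsmul ℝ ℝ) μ with hT
  have hρs := (φ k).hasCompactSupport_normed (μ := μ)
  have hρc : Continuous ((φ k).normed μ) := (φ k).continuous_normed
  have hex : ∀ w : E → F, LocallyIntegrable w μ → ConvolutionExists ((φ k).normed μ) w
      (ContinuousLinearMap.lsmul ℝ ℝ) μ := fun w hw => hρs.convolutionExists_left _ hρc hw
  have hgl : LocallyIntegrable g μ := hg.locallyIntegrable (by norm_num)
  have hhl : LocallyIntegrable h μ := hcont.locallyIntegrable
  have hTc : ∀ w : E → F, LocallyIntegrable w μ → Continuous (T w) := fun w hw =>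
    hρs.continuous_convolution_left _ hρc hw
  have hsub : T (g - h) = T g - T h := by
    have hadd : T (g - h + h) = T (g - h) + T h :=
      (hex _ (hgl.sub hhl)).distrib_add (hex _ hhl)
    rw [sub_add_cancel] at hadd
    rw [hadd, add_sub_cancel_right]
  have hdec : (fun x => T g x - g x) = (T (g - h)) + ((T h - h) + (h - g)) := by
    rw [hsub]; funext x; simp only [Pi.add_apply, Pi.sub_apply]; abel
  have b1 : eLpNorm (T (g - h)) 2 (μ.restrict K) ≤ ε / 3 :=
    (eLpNorm_mono_measure _ Measure.restrict_le_self).trans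
      ((eLpNorm_two_normed_convolution_le (φ k) (hg.sub hhL).1).trans hgh)
  have b2 : eLpNorm (T h - h) 2 (μ.restrict K) ≤ ε / 3 := by
    refine le_trans (eLpNorm_le_of_ae_bound (C := δ) (ae_of_all _ fun x => ?_)) ?_
    · rw [Pi.sub_apply, ← dist_eq_norm]
      refine ContDiffBump.dist_normed_convolution_le hcont.aestronglyMeasurable fun y hy => ?_
      exact (hηu (lt_trans (Metric.mem_ball.1 hy) (hN k hk))).le
    · simpa [hM] using hδM
  have b3 : eLpNorm (h - g) 2 (μ.restrict K) ≤ ε / 3 := by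
    rw [eLpNorm_sub_comm]
    exact (eLpNorm_mono_measure _ Measure.restrict_le_self).trans hgh
  change eLpNorm (fun x => T g x - g x) 2 (μ.restrict K) ≤ ε
  have m1 := (hTc _ (hgl.sub hhl)).aestronglyMeasurable (μ := μ.restrict K)
  have m2 := ((hTc _ hhl).sub hcont).aestronglyMeasurable (μ := μ.restrict K)
  have m3 := (hcont.aestronglyMeasurable (μ := μ.restrict K)).sub hg.1.restrict
  rw [hdec]
  calc _ ≤ ε / 3 + (ε / 3 + ε / 3) :=
        (eLpNorm_add_le m1 (m2.add m3) (by norm_num)).trans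
          (add_le_add b1 ((eLpNorm_add_le m2 m3 (by norm_num)).trans (add_le_add b2 b3)))
    _ = ε := by rw [← add_assoc, ENNReal.add_thirds]

end Mollification

/-! ### Calculus of classical gradients. -/

section Gradient

variable {F : Type*} [NormedAddCommGroup F] [InnerProductSpace ℝ F] [CompleteSpace F]

theorem gradient_comp_real {g : ℝ → ℝ} {g' : ℝ} {w : F → ℝ} {x : F}
    (hg : HasDerivAt g g' (w x)) (hw : DifferentiableAt ℝ w x) :
    gradient (fun y => g (w y)) x = g' • gradient w x := by
  have h := (hg.comp_hasFDerivAt x hw.hasFDerivAt).fderiv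
  rw [Function.comp_def] at h
  simp [gradient, h]

theorem gradient_mul {a b : F → ℝ} {x : F}
    (ha : DifferentiableAt ℝ a x) (hb : DifferentiableAt ℝ b x) :
    gradient (fun y => a y * b y) x = a x • gradient b x + b x • gradient a x := by
  simp [gradient, fderiv_fun_mul ha hb]

theorem continuous_gradient {w : F → ℝ} (hw : ContDiff ℝ 1 w) : Continuous (gradient w) :=
  (InnerProductSpace.toDual ℝ F).symm.continuous.comp (hw.continuous_fderiv one_ne_zero)

theorem gradient_eq_zero_of_notMem_tsupport {w : F → ℝ} {x : F} (hx : x ∉ tsupport w) :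
    gradient w x = 0 := by
  rw [gradient, fderiv_of_notMem_tsupport ℝ hx, map_zero]

end Gradient

/-! ### Smooth approximation of `H^1_loc` functions. -/

section MollifiedGradient

variable {n : ℕ} {Ω : Set (EuclideanSpace ℝ (Fin n))}

theorem IsH1locWithGradient.memLp_restrict {u : EuclideanSpace ℝ (Fin n) → ℝ}
    {G : EuclideanSpace ℝ (Fin n) → EuclideanSpace ℝ (Fin n)} (h : IsH1locWithGradient Ω u G)
    {K : Set (EuclideanSpace ℝ (Fin n))} (hK : IsCompact K) (hKΩ : K ⊆ Ω) :
    MemLp G 2 (volume.restrict K) := (h.2 K hK hKΩ).2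

/-- The weak gradient identity, tested with the translated and reflected mollifier, says that
mollification commutes with the weak gradient away from the boundary. -/
theorem HasWeakGradient.gradient_convolution {u : EuclideanSpace ℝ (Fin n) → ℝ}
    {G : EuclideanSpace ℝ (Fin n) → EuclideanSpace ℝ (Fin n)} (h : HasWeakGradient Ω u G)
    {K : Set (EuclideanSpace ℝ (Fin n))} (hK : IsCompact K) (hKΩ : K ⊆ Ω)
    {ρ : EuclideanSpace ℝ (Fin n) → ℝ} (hρ : ContDiff ℝ ∞ ρ) (hρc : HasCompactSupport ρ)
    {x : EuclideanSpace ℝ (Fin n)} (hx : ∀ y, x - y ∈ tsupport ρ → y ∈ K) :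
    gradient (convolution ρ (K.indicator u) (ContinuousLinearMap.lsmul ℝ ℝ) volume) x =
      convolution ρ (K.indicator G) (ContinuousLinearMap.lsmul ℝ ℝ) volume x := by
  have hKm : MeasurableSet K := hK.isClosed.measurableSet
  have hρ1 : ContDiff ℝ 1 ρ := hρ.of_le (by exact_mod_cast le_top)
  have huK : IntegrableOn u K := h.1.integrableOn_compact_subset hKΩ hK
  have hGK : IntegrableOn G K := h.2.1.integrableOn_compact_subset hKΩ hK
  have hui : Integrable (K.indicator u) := huK.integrable_indicator hKm
  set η : EuclideanSpace ℝ (Fin n) → ℝ := fun y => ρ (x - y) with hη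
  have hηs : tsupport η ⊆ (fun y => x - y) ⁻¹' tsupport ρ :=
    closure_minimal (fun y hy => subset_tsupport _ hy)
      ((isClosed_tsupport ρ).preimage (by fun_prop))
  have hηK : tsupport η ⊆ K := fun y hy => hx y (hηs hy)
  have hηtest : IsTestFunction ∞ Ω η :=
    ⟨hρ.comp (contDiff_const.sub contDiff_id), hK.of_isClosed_subset (isClosed_tsupport _) hηK,
      hηK.trans hKΩ⟩
  have hη1 : ContDiff ℝ 1 η := hηtest.1.of_le (by exact_mod_cast le_top)
  have hgradη : ∀ y, gradient η y = -gradient ρ (x - y) := by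
    intro y
    have h1 : HasFDerivAt η ((fderiv ℝ ρ (x - y)).comp
        (-ContinuousLinearMap.id ℝ (EuclideanSpace ℝ (Fin n)))) y :=
      ((hρ1.differentiable one_ne_zero) (x - y)).hasFDerivAt.comp y ((hasFDerivAt_id y).const_sub x)
    rw [gradient, h1.fderiv]
    simp [gradient]
  have hweak := h.2.2 η hηtest
  have hzero : ∀ y, y ∉ K → η y = 0 := fun y hy => image_eq_zero_of_notMem_tsupport
    fun hy' => hy (hηK hy')
  have hgzero : ∀ y, y ∉ K → gradient η y = 0 := fun y hy => gradient_eq_zero_of_notMem_tsupport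
    fun hy' => hy (hηK hy')
  have hR : ∫ y in Ω, η y • G y =
      convolution ρ (K.indicator G) (ContinuousLinearMap.lsmul ℝ ℝ) volume x := by
    have e1 : ∫ y in Ω, η y • G y = ∫ y, η y • G y := by
      refine setIntegral_eq_integral_of_forall_compl_eq_zero fun y hy => ?_
      rw [hzero y fun hyK => hy (hKΩ hyK), zero_smul]
    rw [convolution_eq_swap, e1]
    congr 1; funext y
    by_cases hy : y ∈ K
    · simp [hy, hη]
    · simp [hy, hzero y hy]
  have hL : ∫ y in Ω, u y • gradient η y = ∫ y, (K.indicator u y) • gradient η y := by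
    have e1 : ∫ y in Ω, u y • gradient η y = ∫ y, u y • gradient η y := by
      refine setIntegral_eq_integral_of_forall_compl_eq_zero fun y hy => ?_
      rw [hgzero y fun hyK => hy (hKΩ hyK), smul_zero]
    rw [e1]
    congr 1; funext y
    by_cases hy : y ∈ K
    · simp [hy]
    · simp [hy, hgzero]
  have hint : Integrable (fun y => (K.indicator u y) • gradient η y) := by
    obtain ⟨C, hC⟩ := (continuous_gradient hη1).bounded_above_of_compact_support
      (hηtest.2.1.mono' fun y hy => by
        by_contra hy'; exact hy (gradient_eq_zero_of_notMem_tsupport hy'))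
    exact hui.smul_bdd C (continuous_gradient hη1).aestronglyMeasurable (ae_of_all _ hC)
  rw [← hR, ← neg_eq_iff_eq_neg.2 hweak, hL]
  refine ext_inner_right ℝ fun a => ?_
  rw [inner_gradient_left, ← convolution_flip,
    (hρc.hasFDerivAt_convolution_right _ hui.locallyIntegrable hρ1 x).fderiv,
    convolution_precompR_apply _ hui.locallyIntegrable (hρc.fderiv ℝ)
      (hρ1.continuous_fderiv one_ne_zero), inner_neg_left, real_inner_comm,
    ← integral_inner hint a, ← integral_neg]
  refine integral_congr_ae (ae_of_all _ fun y => ?_)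
  simp only [hgradη, ContinuousLinearMap.flip_apply, ContinuousLinearMap.lsmul_apply, smul_neg,
    inner_neg_right, neg_neg, inner_smul_right, smul_eq_mul]
  rw [real_inner_comm, inner_gradient_left, mul_comm]

/-- Local approximation of `H^1_loc` functions by smooth functions, keeping positive lower
bounds. -/
theorem IsH1locWithGradient.exists_smooth_approx (hΩ : IsOpen Ω)
    {u : EuclideanSpace ℝ (Fin n) → ℝ} {G : EuclideanSpace ℝ (Fin n) → EuclideanSpace ℝ (Fin n)}
    (h : IsH1locWithGradient Ω u G)
    {K : Set (EuclideanSpace ℝ (Fin n))} (hK : IsCompact K) (hKΩ : K ⊆ Ω) :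
    ∃ w : ℕ → EuclideanSpace ℝ (Fin n) → ℝ, (∀ k, ContDiff ℝ ∞ (w k)) ∧
      (∀ᵐ x ∂volume.restrict K, Tendsto (fun k => w k x) atTop (𝓝 (u x))) ∧
      Tendsto (fun k => eLpNorm (fun x => gradient (w k) x - G x) 2 (volume.restrict K))
        atTop (𝓝 0) ∧
      (LocallyEssPos Ω u → ∃ c : ℝ, 0 < c ∧ ∀ k, ∀ x ∈ K, c ≤ w k x) := by
  obtain ⟨δ, hδ, hδΩ⟩ := hK.exists_cthickening_subset_open hΩ hKΩ
  set K' := Metric.cthickening δ K with hK'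
  have hK'c : IsCompact K' := hK.cthickening
  have hK'm : MeasurableSet K' := hK'c.isClosed.measurableSet
  have hKK' : K ⊆ K' := Metric.self_subset_cthickening K
  have hKm : MeasurableSet K := hK.isClosed.measurableSet
  have hk : ∀ k : ℕ, (0 : ℝ) < (k : ℝ) + 1 := fun k => by positivity
  -- Radii at most `δ` ensure that mollifying at a point of `K` sees only values on `K'`. The fixed
  -- ratio of outer to inner radius is what almost everywhere convergence needs.
  set φ : ℕ → ContDiffBump (0 : EuclideanSpace ℝ (Fin n)) := fun k =>
    ⟨δ / (k + 1) / 2, δ / (k + 1), by have := hk k; positivity,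
      half_lt_self (div_pos hδ (hk k))⟩ with hφ
  have hφle : ∀ k, (φ k).rOut ≤ δ := fun k =>
    div_le_self hδ.le (by have : (0 : ℝ) ≤ k := k.cast_nonneg; linarith)
  have hφ0 : Tendsto (fun k => (φ k).rOut) atTop (𝓝 0) := by
    have := (tendsto_one_div_add_atTop_nhds_zero_nat (𝕜 := ℝ)).const_mul δ
    simpa [hφ, div_eq_mul_inv] using this
  have huK : IntegrableOn u K' := h.1.1.integrableOn_compact_subset hδΩ hK'c
  have hui : Integrable (K'.indicator u) := huK.integrable_indicator hK'm
  have hGL : MemLp (K'.indicator G) 2 volume :=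
    (memLp_indicator_iff_restrict hK'm).2 (h.memLp_restrict hK'c hδΩ)
  have hball : ∀ k, ∀ x ∈ K, ∀ y, x - y ∈ tsupport ((φ k).normed volume) → y ∈ K' := by
    intro k x hx y hy
    rw [(φ k).tsupport_normed_eq, mem_closedBall_zero_iff, ← dist_eq_norm] at hy
    exact Metric.mem_cthickening_of_dist_le y x δ K hx ((dist_comm y x ▸ hy).trans (hφle k))
  refine ⟨fun k => convolution ((φ k).normed volume) (K'.indicator u)
    (ContinuousLinearMap.lsmul ℝ ℝ) volume, fun k => ?_, ?_, ?_, ?_⟩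
  · exact (φ k).hasCompactSupport_normed.contDiff_convolution_left _ (φ k).contDiff_normed
      hui.locallyIntegrable
  · have := ContDiffBump.ae_convolution_tendsto_right_of_locallyIntegrable (K := 2) hφ0
      (Eventually.of_forall fun k => by simp only [hφ]; linarith) hui.locallyIntegrable
    rw [ae_restrict_iff' hKm]
    filter_upwards [this] with x hx hxK
    rwa [Set.indicator_of_mem (hKK' hxK)] at hx
  · refine (tendsto_eLpNorm_normed_convolution_sub hφ0 hGL hK).congr fun k => ?_
    refine eLpNorm_congr_ae ?_
    filter_upwards [ae_restrict_mem hKm] with x hx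
    rw [h.1.gradient_convolution hK'c hδΩ (φ k).contDiff_normed (φ k).hasCompactSupport_normed
      (hball k x hx), Set.indicator_of_mem (hKK' hx) G]
  · intro hpos
    obtain ⟨c, hc, hcu⟩ := hpos K' hK'c hδΩ
    refine ⟨c, hc, fun k x hx => ?_⟩
    rw [ae_restrict_iff' hK'm] at hcu
    have hcont : Continuous ((φ k).normed (volume : Measure (EuclideanSpace ℝ (Fin n)))) :=
      (φ k).continuous_normed
    -- The constant is written as its own average, to be compared with the average of `u ≥ c` over
    -- `K'`.
    have h1 : ∫ y, (φ k).normed volume (x - y) • c = c := by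
      rw [integral_smul_const, integral_sub_left_eq_self ((φ k).normed volume) volume x,
        (φ k).integral_normed, one_smul]
    beta_reduce
    rw [convolution_eq_swap]
    conv_lhs => rw [← h1]
    refine integral_mono_ae ?_ ?_ ?_
    · exact (((φ k).integrable_normed (μ := volume)).comp_sub_left x).smul_const c
    · have := ((φ k).hasCompactSupport_normed (μ := volume)).convolutionExists_left
        (ContinuousLinearMap.lsmul ℝ ℝ) hcont hui.locallyIntegrable x
      exact (convolutionExistsAt_iff_integrable_swap).1 this
    · filter_upwards [hcu] with y hy
      simp only [ContinuousLinearMap.lsmul_apply, smul_eq_mul]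
      by_cases hyK : y ∈ K'
      · rw [Set.indicator_of_mem hyK]
        exact mul_le_mul_of_nonneg_left (hy hyK) ((φ k).nonneg_normed _)
      · rw [image_eq_zero_of_notMem_tsupport fun hm => hyK (hball k x hx y hm), zero_mul, zero_mul]

end MollifiedGradient

/-! ### The weak chain rule and identification of weak gradients. -/

section ChainRule

variable {n : ℕ} {Ω : Set (EuclideanSpace ℝ (Fin n))}

theorem IsTestFunction.mono {k l : WithTop ℕ∞} {φ : EuclideanSpace ℝ (Fin n) → ℝ}
    (h : IsTestFunction k Ω φ) (hlk : l ≤ k) : IsTestFunction l Ω φ :=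
  ⟨h.1.of_le hlk, h.2⟩

theorem IsTestFunction.hasCompactSupport_gradient {k : WithTop ℕ∞}
    {φ : EuclideanSpace ℝ (Fin n) → ℝ} (h : IsTestFunction k Ω φ) :
    HasCompactSupport (gradient φ) :=
  h.2.1.mono' fun y hy => by
    by_contra hy'; exact hy (gradient_eq_zero_of_notMem_tsupport hy')

theorem IsTestFunction.exists_bound {k : WithTop ℕ∞} {φ : EuclideanSpace ℝ (Fin n) → ℝ}
    (h : IsTestFunction k Ω φ) : ∃ M, 0 ≤ M ∧ ∀ x, |φ x| ≤ M := by
  obtain ⟨M, hM⟩ := h.1.continuous.bounded_above_of_compact_support h.2.1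
  exact ⟨M, (norm_nonneg _).trans (hM 0), hM⟩

theorem IsTestFunction.memLp_gradient {φ : EuclideanSpace ℝ (Fin n) → ℝ}
    (h : IsTestFunction 1 Ω φ) (s : Set (EuclideanSpace ℝ (Fin n))) :
    MemLp (gradient φ) 2 (volume.restrict s) :=
  ((continuous_gradient h.1).memLp_of_hasCompactSupport h.hasCompactSupport_gradient).restrict s

/-- Integrals over `Ω` of functions vanishing off the support of a test function. -/
theorem setIntegral_eq_tsupport {F : Type*} [NormedAddCommGroup F] [NormedSpace ℝ F]
    {k : WithTop ℕ∞} {φ : EuclideanSpace ℝ (Fin n) → ℝ} (h : IsTestFunction k Ω φ)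
    {w : EuclideanSpace ℝ (Fin n) → F} (hw : ∀ x, x ∉ tsupport φ → w x = 0) :
    ∫ x in Ω, w x = ∫ x in tsupport φ, w x := by
  rw [setIntegral_eq_integral_of_forall_compl_eq_zero fun x hx => hw x fun hx' => hx (h.2.2 hx'),
    setIntegral_eq_integral_of_forall_compl_eq_zero hw]

theorem memLp_of_continuous_isCompact {F : Type*} [NormedAddCommGroup F]
    {K : Set (EuclideanSpace ℝ (Fin n))} (hK : IsCompact K)
    {w : EuclideanSpace ℝ (Fin n) → F} (hw : Continuous w) : MemLp w 2 (volume.restrict K) := by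
  have : IsFiniteMeasure (volume.restrict K) := isFiniteMeasure_restrict.2 hK.measure_lt_top.ne
  obtain ⟨C, hC⟩ := hK.exists_bound_of_continuousOn hw.continuousOn
  refine MemLp.of_bound hw.aestronglyMeasurable C ?_
  filter_upwards [ae_restrict_mem hK.isClosed.measurableSet] with x hx using hC x hx

theorem integral_mul_inner_gradient_eq_neg {φ w : EuclideanSpace ℝ (Fin n) → ℝ}
    (hφ : IsTestFunction 1 Ω φ) (hw : ContDiff ℝ 1 w) (e : EuclideanSpace ℝ (Fin n)) :
    ∫ x, w x * inner ℝ e (gradient φ x) = -∫ x, φ x * inner ℝ e (gradient w x) := by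
  have hc1 : Continuous fun x => fderiv ℝ φ x e :=
    (hφ.1.continuous_fderiv one_ne_zero).clm_apply continuous_const
  have hc2 : Continuous fun x => fderiv ℝ w x e :=
    (hw.continuous_fderiv one_ne_zero).clm_apply continuous_const
  have hs1 : HasCompactSupport fun x => fderiv ℝ φ x e := hφ.2.1.fderiv_apply ℝ e
  have := integral_mul_fderiv_eq_neg_fderiv_mul_of_integrable (μ := volume) (f := w) (g := φ)
    (v := e)
    ((hc2.mul hφ.1.continuous).integrable_of_hasCompactSupport hφ.2.1.mul_left)
    ((hw.continuous.mul hc1).integrable_of_hasCompactSupport hs1.mul_left)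
    ((hw.continuous.mul hφ.1.continuous).integrable_of_hasCompactSupport hφ.2.1.mul_left)
    (fun x _ => hw.differentiable one_ne_zero x) (fun x _ => hφ.1.differentiable one_ne_zero x)
  have hin : ∀ f x, inner ℝ e (gradient f x) = fderiv ℝ f x e := fun f x => by
    rw [real_inner_comm, inner_gradient_left]
  simp only [hin]
  rw [this]
  congr 1
  exact integral_congr_ae (ae_of_all _ fun x => mul_comm _ _)

variable {u : EuclideanSpace ℝ (Fin n) → ℝ}
  {G : EuclideanSpace ℝ (Fin n) → EuclideanSpace ℝ (Fin n)}

/-- The chain rule for weak gradients, in weak form. -/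
theorem IsH1locWithGradient.integral_comp_mul_inner_gradient (hΩ : IsOpen Ω)
    (h : IsH1locWithGradient Ω u G) {g : ℝ → ℝ} {C : ℝ} (hg : ContDiff ℝ 1 g)
    (hgC : ∀ t, |g t| ≤ C) (hgC' : ∀ t, |deriv g t| ≤ C)
    {φ : EuclideanSpace ℝ (Fin n) → ℝ} (hφ : IsTestFunction 1 Ω φ)
    (e : EuclideanSpace ℝ (Fin n)) :
    ∫ x in Ω, g (u x) * inner ℝ e (gradient φ x) =
      -∫ x in Ω, (φ x * deriv g (u x)) * inner ℝ e (G x) := by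
  set K := tsupport φ with hK
  have hKc : IsCompact K := hφ.2.1
  have hfin : IsFiniteMeasure (volume.restrict K) := isFiniteMeasure_restrict.2 hKc.measure_lt_top.ne
  obtain ⟨w, hws, hwae, hwG, -⟩ := h.exists_smooth_approx hΩ hKc hφ.2.2
  have hw1 : ∀ k, ContDiff ℝ 1 (w k) := fun k => (hws k).of_le (by exact_mod_cast le_top)
  obtain ⟨M, hM0, hM⟩ := hφ.exists_bound
  have hg' : Continuous (deriv g) := hg.continuous_deriv le_rfl
  have hGK : MemLp G 2 (volume.restrict K) := h.memLp_restrict hKc hφ.2.2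
  rw [setIntegral_eq_tsupport hφ fun x hx => by
      rw [gradient_eq_zero_of_notMem_tsupport hx, inner_zero_right, mul_zero],
    setIntegral_eq_tsupport hφ fun x hx => by
      rw [image_eq_zero_of_notMem_tsupport hx, zero_mul, zero_mul]]
  have hL := tendsto_integral_mul_inner (μ := volume.restrict K) (b := fun k x => g (w k x))
    (b₀ := fun x => g (u x)) (C := C) (X := fun _ => e) (Y := fun _ => gradient φ)
    (Y₀ := gradient φ)
    (fun k => (hg.continuous.comp (hws k).continuous).aestronglyMeasurable)
    (fun k => ae_of_all _ fun x => hgC _)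
    (by filter_upwards [hwae] with x hx using (hg.continuous.tendsto _).comp hx)
    (memLp_const e) (fun _ => hφ.memLp_gradient K) (hφ.memLp_gradient K) (by simp)
  have hR := tendsto_integral_mul_inner (μ := volume.restrict K)
    (b := fun k x => φ x * deriv g (w k x))
    (b₀ := fun x => φ x * deriv g (u x)) (C := M * C) (X := fun _ => e)
    (Y := fun k => gradient (w k)) (Y₀ := G)
    (fun k => (hφ.1.continuous.mul (hg'.comp (hws k).continuous)).aestronglyMeasurable)
    (fun k => ae_of_all _ fun x => by
      rw [abs_mul]; exact mul_le_mul (hM x) (hgC' _) (abs_nonneg _) hM0)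
    (by filter_upwards [hwae] with x hx using ((hg'.tendsto _).comp hx).const_mul _)
    (memLp_const e) (fun k => memLp_of_continuous_isCompact hKc (continuous_gradient (hw1 k)))
    hGK hwG
  -- For the smooth `w k` the identity is classical integration by parts, and both sides converge.
  refine tendsto_nhds_unique hL (hR.neg.congr fun k => ?_)
  have hibp := integral_mul_inner_gradient_eq_neg hφ (hg.comp (hw1 k)) e
  rw [← setIntegral_eq_integral_of_forall_compl_eq_zero (s := K) fun x hx => by
      rw [gradient_eq_zero_of_notMem_tsupport hx, inner_zero_right, mul_zero],
    ← setIntegral_eq_integral_of_forall_compl_eq_zero (s := K) (f := fun x => φ x * _)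
      fun x hx => by rw [image_eq_zero_of_notMem_tsupport hx, zero_mul]] at hibp
  rw [show ∫ x in K, g (w k x) * inner ℝ e (gradient φ x) = _ from hibp]
  congr 1
  refine integral_congr_ae (ae_of_all _ fun x => ?_)
  simp only [Function.comp_def]
  rw [gradient_comp_real ((hg.differentiable one_ne_zero) (w k x)).hasDerivAt
    ((hw1 k).differentiable one_ne_zero x), inner_smul_right]
  ring

theorem IsH1locWithGradient.sub {v : EuclideanSpace ℝ (Fin n) → ℝ}
    {H : EuclideanSpace ℝ (Fin n) → EuclideanSpace ℝ (Fin n)}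
    (hu : IsH1locWithGradient Ω u G) (hv : IsH1locWithGradient Ω v H) :
    IsH1locWithGradient Ω (fun x => u x - v x) (fun x => G x - H x) := by
  refine ⟨⟨hu.1.1.sub hv.1.1, hu.1.2.1.sub hv.1.2.1, fun φ hφ => ?_⟩, fun K hK hKΩ =>
    ⟨(hu.2 K hK hKΩ).1.sub (hv.2 K hK hKΩ).1, (hu.2 K hK hKΩ).2.sub (hv.2 K hK hKΩ).2⟩⟩
  have h1 := hu.1.2.2 φ hφ
  have h2 := hv.1.2.2 φ hφ
  have hz : ∀ x, x ∉ tsupport φ → φ x = 0 := fun x hx => image_eq_zero_of_notMem_tsupport hx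
  have hgz : ∀ x, x ∉ tsupport φ → gradient φ x = 0 := fun x hx =>
    gradient_eq_zero_of_notMem_tsupport hx
  have hφ1 : ContDiff ℝ 1 φ := hφ.1.of_le (by exact_mod_cast le_top)
  obtain ⟨M, -, hM⟩ := hφ.exists_bound
  obtain ⟨C, hC⟩ := (continuous_gradient hφ1).bounded_above_of_compact_support
    hφ.hasCompactSupport_gradient
  have hi1 : ∀ {w : EuclideanSpace ℝ (Fin n) → ℝ}, LocallyIntegrableOn w Ω →
      Integrable (fun x => w x • gradient φ x) (volume.restrict (tsupport φ)) := fun hw =>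
    (hw.integrableOn_compact_subset hφ.2.2 hφ.2.1).smul_bdd C
      (continuous_gradient hφ1).aestronglyMeasurable (ae_of_all _ hC)
  have hi2 : ∀ {w : EuclideanSpace ℝ (Fin n) → EuclideanSpace ℝ (Fin n)},
      LocallyIntegrableOn w Ω →
      Integrable (fun x => φ x • w x) (volume.restrict (tsupport φ)) := fun hw =>
    (hw.integrableOn_compact_subset hφ.2.2 hφ.2.1).bdd_smul M
      hφ.1.continuous.aestronglyMeasurable (ae_of_all _ hM)
  rw [setIntegral_eq_tsupport hφ fun x hx => by rw [hgz x hx, smul_zero],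
    setIntegral_eq_tsupport hφ fun x hx => by rw [hz x hx, zero_smul]] at h1 h2 ⊢
  simp only [sub_smul, smul_sub]
  rw [integral_sub (hi1 hu.1.1) (hi1 hv.1.1), integral_sub (hi2 hu.1.2.1) (hi2 hv.1.2.1), h1, h2]
  abel

/-- Two fields with equal weighted weak action agree where the weight is nonzero. -/
theorem ae_smul_eq_zero_of_integral_mul_inner_eq (hΩ : IsOpen Ω) {b : EuclideanSpace ℝ (Fin n) → ℝ}
    {C : ℝ} {X Y : EuclideanSpace ℝ (Fin n) → EuclideanSpace ℝ (Fin n)}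
    (hbm : AEStronglyMeasurable b (volume.restrict Ω)) (hb : ∀ x, |b x| ≤ C)
    (hX : LocallyIntegrableOn X Ω) (hY : LocallyIntegrableOn Y Ω)
    (hXY : ∀ φ : EuclideanSpace ℝ (Fin n) → ℝ, IsTestFunction ∞ Ω φ →
      ∀ e : EuclideanSpace ℝ (Fin n), ∫ x in Ω, (φ x * b x) * inner ℝ e (X x) =
        ∫ x in Ω, (φ x * b x) * inner ℝ e (Y x)) :
    ∀ᵐ x ∂volume.restrict Ω, b x • (X x - Y x) = 0 := by
  have hloc : ∀ {Z : EuclideanSpace ℝ (Fin n) → EuclideanSpace ℝ (Fin n)},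
      LocallyIntegrableOn Z Ω → ∀ K ⊆ Ω, IsCompact K → IntegrableOn (fun x => b x • Z x) K :=
    fun hZ K hKΩ hK => (hZ.integrableOn_compact_subset hKΩ hK).bdd_smul C
      (hbm.mono_measure (Measure.restrict_mono_set _ hKΩ)) (ae_of_all _ hb)
  rw [ae_restrict_iff' hΩ.measurableSet]
  refine hΩ.ae_eq_zero_of_integral_contDiff_smul_eq_zero
    ((locallyIntegrableOn_iff hΩ.isLocallyClosed).2 (hloc (hX.sub hY))) fun φ hφ hφc hφΩ => ?_
  have hφt : IsTestFunction ∞ Ω φ := ⟨hφ, hφc, hφΩ⟩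
  obtain ⟨M, -, hM⟩ := hφt.exists_bound
  have hi : ∀ {Z : EuclideanSpace ℝ (Fin n) → EuclideanSpace ℝ (Fin n)},
      LocallyIntegrableOn Z Ω →
      Integrable (fun x => φ x • b x • Z x) (volume.restrict (tsupport φ)) := fun hZ =>
    (hloc hZ _ hφΩ hφc).bdd_smul M hφ.continuous.aestronglyMeasurable (ae_of_all _ hM)
  have hz : ∀ x, x ∉ tsupport φ → φ x = 0 := fun x hx => image_eq_zero_of_notMem_tsupport hx
  rw [← setIntegral_eq_integral_of_forall_compl_eq_zero (s := tsupport φ)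
    fun x hx => by rw [hz x hx, zero_smul]]
  simp only [smul_sub]
  rw [integral_sub (hi hX) (hi hY)]
  refine ext_inner_left ℝ fun e => ?_
  rw [inner_sub_right, inner_zero_right, ← integral_inner (hi hX), ← integral_inner (hi hY),
    sub_eq_zero]
  have := hXY φ hφt e
  rw [setIntegral_eq_tsupport hφt fun x hx => by rw [hz x hx, zero_mul, zero_mul],
    setIntegral_eq_tsupport hφt fun x hx => by rw [hz x hx, zero_mul, zero_mul]] at this
  simpa only [inner_smul_right, mul_assoc] using this

/-- A bounded `C^1` function with bounded derivative, vanishing exactly on the negative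
half-line together with its derivative. -/
theorem exists_contDiff_posPart_profile : ∃ g : ℝ → ℝ, ContDiff ℝ 1 g ∧ (∀ t, |g t| ≤ 1) ∧
    (∀ t, |deriv g t| ≤ 1) ∧ (∀ t, g (max t 0) = g t) ∧ (∀ t, deriv g (max t 0) = deriv g t) ∧
    ∀ t, 0 < t → deriv g t ≠ 0 := by
  have hsq : ∀ t : ℝ, HasDerivAt (fun t : ℝ => max t 0 ^ 2) (2 * max t 0) t := by
    intro t
    rcases lt_trichotomy t 0 with ht | rfl | ht
    · rw [max_eq_right ht.le, mul_zero]
      refine (hasDerivAt_const t (0 : ℝ)).congr_of_eventuallyEq ?_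
      filter_upwards [gt_mem_nhds ht] with s hs
      simp [max_eq_right hs.le]
    · rw [max_self, mul_zero, hasDerivAt_iff_isLittleO_nhds_zero]
      refine Asymptotics.IsBigO.trans_isLittleO (g := fun h : ℝ => h ^ 2) ?_ ?_
      · refine Asymptotics.IsBigO.of_bound 1 (Eventually.of_forall fun h => ?_)
        simp only [zero_add, max_self, smul_zero, sub_zero, norm_pow, Real.norm_eq_abs, one_mul,
          ne_eq, OfNat.ofNat_ne_zero, not_false_eq_true, zero_pow]
        refine pow_le_pow_left₀ (abs_nonneg _) ?_ 2
        rw [abs_of_nonneg (le_max_right _ _)]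
        exact max_le (le_abs_self _) (abs_nonneg _)
      · simpa using Asymptotics.isLittleO_pow_pow (𝕜 := ℝ) (m := 1) (n := 2) (by norm_num)
    · rw [max_eq_left ht.le]
      have := hasDerivAt_pow 2 t
      simp only [Nat.cast_ofNat, Nat.add_one_sub_one, pow_one] at this
      refine this.congr_of_eventuallyEq ?_
      filter_upwards [lt_mem_nhds ht] with s hs
      simp [max_eq_left hs.le]
  have hpos : ∀ t : ℝ, 0 < 1 + max t 0 ^ 2 := fun t => by positivity
  have hd : ∀ t : ℝ, HasDerivAt (fun t : ℝ => max t 0 ^ 2 / (1 + max t 0 ^ 2))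
      (2 * max t 0 / (1 + max t 0 ^ 2) ^ 2) t := by
    intro t
    refine ((hsq t).div ((hsq t).const_add 1) (hpos t).ne').congr_deriv ?_
    congr 1; ring
  have hderiv : deriv (fun t : ℝ => max t 0 ^ 2 / (1 + max t 0 ^ 2)) =
      fun t => 2 * max t 0 / (1 + max t 0 ^ 2) ^ 2 := funext fun t => (hd t).deriv
  -- Squaring the positive part removes its corner; the denominator keeps the function and its
  -- derivative bounded.
  refine ⟨fun t => max t 0 ^ 2 / (1 + max t 0 ^ 2), ?_, fun t => ?_, fun t => ?_, fun t => ?_,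
    fun t => ?_, fun t ht => ?_⟩
  · rw [contDiff_one_iff_deriv, hderiv]
    refine ⟨fun t => (hd t).differentiableAt, ?_⟩
    exact Continuous.div (by fun_prop) (by fun_prop) fun t => (pow_pos (hpos t) 2).ne'
  · rw [abs_of_nonneg (by positivity), div_le_one (hpos t)]
    linarith
  · have hm : 0 ≤ max t 0 := le_max_right _ _
    rw [hderiv, abs_of_nonneg (by positivity), div_le_one (by positivity)]
    nlinarith [sq_nonneg (max t 0 - 1), sq_nonneg (max t 0 ^ 2)]
  · simp
  · simp [hderiv]
  · rw [hderiv]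
    simp only [max_eq_left ht.le]
    positivity

end ChainRule

/-! ### Gradient of the positive part, the Caccioppoli inequality, smooth steps. -/

section Caccioppoli

variable {n : ℕ} {Ω : Set (EuclideanSpace ℝ (Fin n))}
  {u v f : EuclideanSpace ℝ (Fin n) → ℝ}
  {G H : EuclideanSpace ℝ (Fin n) → EuclideanSpace ℝ (Fin n)}

/-- The weak gradient of `(u - ε)⁺` is that of `u` on `{u > ε}`. -/
theorem IsH1locWithGradient.ae_eq_of_posPart (hΩ : IsOpen Ω) (hu : IsH1locWithGradient Ω u G)
    {ε : ℝ} (hz : IsH1locWithGradient Ω (fun x => max (u x - ε) 0) H) :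
    ∀ᵐ x ∂volume.restrict Ω, ε < u x → H x = G x := by
  obtain ⟨g, hg, hg1, hg1', hgm, hgm', hg0⟩ := exists_contDiff_posPart_profile
  have hshift : deriv (fun t => g (t - ε)) = fun t => deriv g (t - ε) :=
    funext fun t => deriv_comp_sub_const g ε t
  -- Since `g` sees only the positive part, `g (u - ε)` and `g ((u - ε)⁺)` coincide. The chain rule
  -- computes their common gradient in two ways, with the same weight.
  have key := ae_smul_eq_zero_of_integral_mul_inner_eq hΩ (b := fun x => deriv g (u x - ε))
    (X := H) (Y := G)
    ((hg.continuous_deriv le_rfl).comp_aestronglyMeasurable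
      (hu.1.1.aestronglyMeasurable.sub aestronglyMeasurable_const))
    (fun x => hg1' _) hz.1.2.1 hu.1.2.1 fun φ hφ e => by
      have hφ1 : IsTestFunction 1 Ω φ := hφ.mono (by exact_mod_cast le_top)
      have h1 := hz.integral_comp_mul_inner_gradient hΩ hg hg1 hg1' hφ1 e
      have h2 := hu.integral_comp_mul_inner_gradient hΩ (g := fun t => g (t - ε))
        (hg.comp (contDiff_id.sub contDiff_const)) (fun t => hg1 _)
        (fun t => by rw [hshift]; exact hg1' _) hφ1 e
      simp only [hgm, hgm', hshift] at h1 h2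
      rw [h1] at h2
      exact neg_injective h2
  filter_upwards [key] with x hx hux
  exact sub_eq_zero.1 ((smul_eq_zero.1 hx).resolve_left (hg0 _ (sub_pos.2 hux)))

/-- The Caccioppoli (Hardy type) inequality for positive weakly superharmonic functions. -/
theorem eLpNorm_div_smul_le_of_superharmonic (hΩ : IsOpen Ω) (hpos : LocallyEssPos Ω v)
    (hv : IsH1locWithGradient Ω v G)
    (hsup : ∀ φ : EuclideanSpace ℝ (Fin n) → ℝ, IsTestFunction 1 Ω φ → (∀ x, 0 ≤ φ x) →
      0 ≤ ∫ x in Ω, inner ℝ (G x) (gradient φ x))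
    {φ : EuclideanSpace ℝ (Fin n) → ℝ} (hφ : IsTestFunction 1 Ω φ) :
    eLpNorm (fun x => (φ x / v x) • G x) 2 (volume.restrict Ω) ≤
      2 * eLpNorm (gradient φ) 2 (volume.restrict Ω) := by
  set K := tsupport φ with hK
  have hKc : IsCompact K := hφ.2.1
  have hKm : MeasurableSet K := hKc.isClosed.measurableSet
  have hfin : IsFiniteMeasure (volume.restrict K) := isFiniteMeasure_restrict.2 hKc.measure_lt_top.ne
  obtain ⟨w, hws, hwae, hwG, hwpos⟩ := hv.exists_smooth_approx hΩ hKc hφ.2.2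
  obtain ⟨c, hc, hcw⟩ := hwpos hpos
  have hw1 : ∀ k, ContDiff ℝ 1 (w k) := fun k => (hws k).of_le (by exact_mod_cast le_top)
  obtain ⟨M, hM0, hM⟩ := hφ.exists_bound
  have hGK : MemLp G 2 (volume.restrict K) := hv.memLp_restrict hKc hφ.2.2
  have hφz : ∀ x, x ∉ K → φ x = 0 := fun x hx => image_eq_zero_of_notMem_tsupport hx
  have hφgz : ∀ x, x ∉ K → gradient φ x = 0 := fun x hx => gradient_eq_zero_of_notMem_tsupport hx
  have hcv : ∀ᵐ x ∂volume.restrict K, c ≤ v x := by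
    filter_upwards [hwae, ae_restrict_mem hKm] with x hx hxK
    exact ge_of_tendsto' hx fun k => hcw k x hxK
  have hφgL := hφ.memLp_gradient K
  have hq : ∀ k, ∀ᵐ x ∂volume.restrict K, |φ x / w k x| ≤ M / c := fun k => by
    filter_upwards [ae_restrict_mem hKm] with x hx
    rw [abs_div, abs_of_pos (hc.trans_le (hcw k x hx))]
    exact div_le_div₀ hM0 (hM x) hc (hcw k x hx)
  have hqm : ∀ k, AEStronglyMeasurable (fun x => φ x / w k x) (volume.restrict K) := fun k =>
    (hφ.1.continuous.measurable.div (hws k).continuous.measurable).aestronglyMeasurable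
  -- the inequality tested with the smooth approximations
  have hineq : ∀ k, 0 ≤ (∫ x in K, (2 * (φ x / w k x)) * inner ℝ (G x) (gradient φ x)) -
      ∫ x in K, (φ x / w k x) ^ 2 * inner ℝ (G x) (gradient (w k) x) := by
    intro k
    have hwne : ∀ x ∈ K, w k x ≠ 0 := fun x hx => (hc.trans_le (hcw k x hx)).ne'
    -- The classical choice `φ² / v`, with `v` replaced by a smooth approximation bounded below by
    -- `c` on `K`.
    set ψ : EuclideanSpace ℝ (Fin n) → ℝ := fun x => (φ x * φ x) * (w k x)⁻¹ with hψ
    have hψsupp : tsupport ψ ⊆ K := closure_mono fun x hx => by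
      contrapose! hx
      simp [hψ, Function.notMem_support.1 hx]
    have hψt : IsTestFunction 1 Ω ψ := by
      refine ⟨contDiff_iff_contDiffAt.2 fun x => ?_,
        hKc.of_isClosed_subset (isClosed_tsupport _) hψsupp, hψsupp.trans hφ.2.2⟩
      -- Off `K` the denominator may vanish, but `ψ` is identically zero near such a point.
      by_cases hx : x ∈ K
      · exact (hφ.1.mul hφ.1).contDiffAt.mul ((hw1 k).contDiffAt.inv (hwne x hx))
      · refine (contDiffAt_const (c := (0 : ℝ))).congr_of_eventuallyEq ?_
        exact notMem_tsupport_iff_eventuallyEq.1 fun h => hx (hψsupp h)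
    have hψ0 : ∀ x, 0 ≤ ψ x := fun x => by
      by_cases hx : x ∈ K
      · exact mul_nonneg (mul_self_nonneg _) (inv_nonneg.2 (hc.le.trans (hcw k x hx)))
      · simp [hψ, hφz x hx]
    have h0 := hsup ψ hψt hψ0
    rw [setIntegral_eq_tsupport hφ fun x hx => by
      rw [gradient_eq_zero_of_notMem_tsupport fun h => hx (hψsupp h), inner_zero_right]] at h0
    rw [← integral_sub]
    · refine h0.trans_eq (integral_congr_ae ?_)
      filter_upwards [ae_restrict_mem hKm] with x hx
      have hd := hφ.1.differentiable one_ne_zero x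
      have hdw := (hw1 k).differentiable one_ne_zero x
      have hw0 := hwne x hx
      rw [hψ, gradient_mul (a := fun y => φ y * φ y) (b := fun y => (w k y)⁻¹)
        (hd.mul hd) (hdw.inv hw0), gradient_mul hd hd,
        gradient_comp_real (hasDerivAt_inv hw0) hdw]
      simp only [inner_add_right, inner_smul_right]
      field_simp
      ring
    · exact integrable_mul_inner (C := 2 * (M / c)) ((hqm k).const_mul 2) (by
        filter_upwards [hq k] with x hx
        rw [abs_mul, abs_two]; linarith) hGK hφgL
    · exact integrable_mul_inner (C := (M / c) ^ 2) ((hqm k).pow 2) (by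
        filter_upwards [hq k] with x hx
        rw [abs_pow]; gcongr) hGK (memLp_of_continuous_isCompact hKc (continuous_gradient (hw1 k)))
  have hqlim : ∀ᵐ x ∂volume.restrict K,
      Tendsto (fun k => φ x / w k x) atTop (𝓝 (φ x / v x)) := by
    filter_upwards [hwae, hcv] with x hx hvx
    exact tendsto_const_nhds.div hx (hc.trans_le hvx).ne'
  have hlim1 := tendsto_integral_mul_inner (μ := volume.restrict K)
    (b := fun k x => 2 * (φ x / w k x)) (b₀ := fun x => 2 * (φ x / v x)) (C := 2 * (M / c))
    (X := G) (Y := fun _ => gradient φ) (Y₀ := gradient φ)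
    (fun k => (hqm k).const_mul 2)
    (fun k => by
      filter_upwards [hq k] with x hx
      rw [abs_mul, abs_two]; linarith)
    (by filter_upwards [hqlim] with x hx using hx.const_mul 2)
    hGK (fun _ => hφgL) hφgL (by simp)
  have hlim2 := tendsto_integral_mul_inner (μ := volume.restrict K)
    (b := fun k x => (φ x / w k x) ^ 2) (b₀ := fun x => (φ x / v x) ^ 2) (C := (M / c) ^ 2)
    (X := G) (Y := fun k => gradient (w k)) (Y₀ := G)
    (fun k => (hqm k).pow 2)
    (fun k => by
      filter_upwards [hq k] with x hx
      rw [abs_pow]; gcongr)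
    (by filter_upwards [hqlim] with x hx using hx.pow 2)
    hGK (fun k => memLp_of_continuous_isCompact hKc (continuous_gradient (hw1 k))) hGK hwG
  have hlim := ge_of_tendsto' (hlim1.sub hlim2) hineq
  -- the resulting `L²` bound
  have hvm : AEStronglyMeasurable v (volume.restrict K) := (hv.2 K hKc hφ.2.2).1.1
  have hQm : AEStronglyMeasurable (fun x => φ x / v x) (volume.restrict K) :=
    (hφ.1.continuous.aestronglyMeasurable.aemeasurable.div hvm.aemeasurable).aestronglyMeasurable
  have hQ : ∀ᵐ x ∂volume.restrict K, |φ x / v x| ≤ M / c := by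
    filter_upwards [hcv] with x hx
    rw [abs_div, abs_of_pos (hc.trans_le hx)]
    exact div_le_div₀ hM0 (hM x) hc hx
  have hQG : MemLp (fun x => (φ x / v x) • G x) 2 (volume.restrict K) := by
    refine MemLp.of_le_mul (c := M / c) hGK (hQm.smul hGK.1) ?_
    filter_upwards [hQ] with x hx
    rw [norm_smul]
    exact mul_le_mul_of_nonneg_right hx (norm_nonneg _)
  have hI1 := integrable_mul_inner (C := 2 * (M / c)) (hQm.const_mul 2) (by
        filter_upwards [hQ] with x hx
        rw [abs_mul, abs_two]; linarith) hGK hφgL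
  have hI2 := integrable_inner_of_memLp hQG hQG
  have hI3 := integrable_inner_of_memLp hφgL hφgL
  have hbound : ∫ x in K, ‖(φ x / v x) • G x‖ ^ 2 ≤ 4 * ∫ x in K, ‖gradient φ x‖ ^ 2 := by
    have e2 : ∀ x, (φ x / v x) ^ 2 * inner ℝ (G x) (G x) =
        inner ℝ ((φ x / v x) • G x) ((φ x / v x) • G x) := fun x => by
      rw [real_inner_smul_left, real_inner_smul_right]; ring
    simp only [e2] at hlim
    -- Young's inequality `2 a·b ≤ |a|² / 2 + 2 |b|²` with `a = (φ / v) ∇v`, `b = ∇φ`. Half of the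
    -- finite integral of `|a|²` is absorbed, whence the factor `4`.
    have hle : ∫ x in K, 2 * (φ x / v x) * inner ℝ (G x) (gradient φ x) ≤
        ∫ x in K, ((1 / 2) * inner ℝ ((φ x / v x) • G x) ((φ x / v x) • G x) +
          2 * inner ℝ (gradient φ x) (gradient φ x)) := by
      refine integral_mono hI1 ((hI2.const_mul _).add (hI3.const_mul _)) fun x => ?_
      have h0 : 0 ≤ inner ℝ ((φ x / v x) • G x - (2 : ℝ) • gradient φ x)
        ((φ x / v x) • G x - (2 : ℝ) • gradient φ x) := real_inner_self_nonneg
      rw [real_inner_sub_sub_self] at h0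
      simp only [real_inner_smul_left, real_inner_smul_right] at h0 ⊢
      linarith
    rw [integral_add (hI2.const_mul _) (hI3.const_mul _), integral_const_mul,
      integral_const_mul] at hle
    simp only [← real_inner_self_eq_norm_sq]
    linarith
  rw [eLpNorm_restrict_eq_of_support_subset (s := Ω), eLpNorm_restrict_eq_of_support_subset (s := Ω),
    ← eLpNorm_restrict_eq_of_support_subset (s := K),
    ← eLpNorm_restrict_eq_of_support_subset (s := K) (f := gradient φ)]
  · rw [hQG.eLpNorm_eq_integral_rpow_norm (by norm_num) (by norm_num),
      hφgL.eLpNorm_eq_integral_rpow_norm (by norm_num) (by norm_num),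
      ENNReal.toReal_ofNat]
    have e2 : ∀ N : ℝ, 2 * ENNReal.ofReal N = ENNReal.ofReal (2 * N) := fun N => by
      rw [ENNReal.ofReal_mul two_pos.le, ENNReal.ofReal_ofNat]
    rw [e2]
    refine ENNReal.ofReal_le_ofReal ?_
    simp only [Real.rpow_ofNat]
    rw [← one_div, ← Real.sqrt_eq_rpow, ← Real.sqrt_eq_rpow]
    calc √(∫ x in K, ‖(φ x / v x) • G x‖ ^ 2) ≤ √(2 ^ 2 * ∫ x in K, ‖gradient φ x‖ ^ 2) :=
          Real.sqrt_le_sqrt (by linarith)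
      _ = 2 * √(∫ x in K, ‖gradient φ x‖ ^ 2) := by
          rw [Real.sqrt_mul (by norm_num), Real.sqrt_sq (by norm_num)]
  · exact fun x hx => by_contra fun h => hx (hφgz x h)
  · exact fun x hx => by_contra fun h => hx (by simp [hφz x h])
  · exact fun x hx => by_contra fun h => hx (hφgz x fun h' => h (hφ.2.2 h'))
  · exact fun x hx => by_contra fun h => hx (by simp [hφz x fun h' => h (hφ.2.2 h')])

/-- A smooth monotone step from `0` on `(-∞, a]` to `1` on `[b, ∞)`. -/
theorem exists_smooth_step {a b : ℝ} (hab : a < b) : ∃ q : ℝ → ℝ, ContDiff ℝ ∞ q ∧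
    Monotone q ∧ (∀ t, 0 ≤ q t) ∧ (∀ t, |q t| ≤ 1) ∧ (∃ C, 0 ≤ C ∧ ∀ t, |deriv q t| ≤ C) ∧
    (∀ t ≤ a, q t = 0 ∧ deriv q t = 0) ∧ (∀ t, a < t → 0 < q t) ∧
    ∀ t, b ≤ t → q t = 1 ∧ deriv q t = 0 := by
  have hba : 0 < b - a := sub_pos.2 hab
  set q : ℝ → ℝ := fun t => Real.smoothTransition ((t - a) / (b - a)) with hq
  have hqs : ContDiff ℝ ∞ q := Real.smoothTransition.contDiff.comp (by fun_prop)
  have h0 : ∀ t, 0 ≤ q t := fun t => Real.smoothTransition.nonneg _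
  have h1 : ∀ t, q t ≤ 1 := fun t => Real.smoothTransition.le_one _
  have hlo : ∀ t ≤ a, q t = 0 := fun t ht =>
    Real.smoothTransition.zero_of_nonpos (div_nonpos_of_nonpos_of_nonneg (by linarith) hba.le)
  have hhi : ∀ t, b ≤ t → q t = 1 := fun t ht =>
    Real.smoothTransition.one_of_one_le ((one_le_div hba).2 (by linarith))
  -- The values `0` and `1` are global extrema of `q`, so the derivative vanishes there, endpoints
  -- included.
  have hlo' : ∀ t ≤ a, deriv q t = 0 := fun t ht =>
    IsLocalMin.deriv_eq_zero (Eventually.of_forall fun s => by rw [hlo t ht]; exact h0 s)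
  have hhi' : ∀ t, b ≤ t → deriv q t = 0 := fun t ht =>
    IsLocalMax.deriv_eq_zero (Eventually.of_forall fun s => by rw [hhi t ht]; exact h1 s)
  obtain ⟨C, hC⟩ := (isCompact_Icc (a := a) (b := b)).exists_bound_of_continuousOn
    (hqs.continuous_deriv (by exact_mod_cast le_top)).continuousOn
  refine ⟨q, hqs, fun s t hst => Real.smoothTransition.monotone (by gcongr), h0, fun t => ?_,
    ⟨max C 0, le_max_right _ _, fun t => ?_⟩, fun t ht => ⟨hlo t ht, hlo' t ht⟩, fun t ht =>
      Real.smoothTransition.pos_of_pos (div_pos (sub_pos.2 ht) hba), fun t ht =>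
      ⟨hhi t ht, hhi' t ht⟩⟩
  · rw [abs_of_nonneg (h0 t)]; exact h1 t
  · rcases le_total t a with hta | hta
    · simp [hlo' t hta]
    · rcases le_total b t with htb | htb
      · simp [hhi' t htb]
      · exact (hC t ⟨hta, htb⟩).trans (le_max_left _ _)

end Caccioppoli

/-! ### Testing the difference of the two inequalities. -/

section Testing

variable {n : ℕ} {Ω : Set (EuclideanSpace ℝ (Fin n))} {β : ℝ}
  {u v f : EuclideanSpace ℝ (Fin n) → ℝ}
  {G H : EuclideanSpace ℝ (Fin n) → EuclideanSpace ℝ (Fin n)}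

/-- An open set is a countable union of compact sets, so the local lower bounds combine. -/
theorem LocallyEssPos.ae_pos (hΩ : IsOpen Ω) (h : LocallyEssPos Ω u) :
    ∀ᵐ x ∂volume.restrict Ω, 0 < u x := by
  have : LocallyCompactSpace Ω := hΩ.locallyCompactSpace
  obtain ⟨K, hK, hKΩ⟩ : IsSigmaCompact Ω := isSigmaCompact_iff_sigmaCompactSpace.2 inferInstance
  rw [← hKΩ, ae_restrict_iUnion_iff]
  intro k
  obtain ⟨c, hc, hcu⟩ := h (K k) (hK k) (hKΩ ▸ Set.subset_iUnion K k)
  filter_upwards [hcu] with x hx using hc.trans_le hx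

/-- The local lower bound `c` makes the singular factor at most `c ^ (-β)`. -/
theorem LocallyEssPos.integrableOn_div_rpow (h : LocallyEssPos Ω u)
    (hum : AEStronglyMeasurable u (volume.restrict Ω)) (hβ : 0 ≤ β) (hf : IntegrableOn f Ω)
    {K : Set (EuclideanSpace ℝ (Fin n))} (hK : IsCompact K) (hKΩ : K ⊆ Ω) :
    IntegrableOn (fun x => f x / u x ^ β) K := by
  obtain ⟨c, hc, hcu⟩ := h K hK hKΩ
  have hm : AEStronglyMeasurable (fun x => (u x ^ β)⁻¹) (volume.restrict K) :=
    ((hum.mono_measure (Measure.restrict_mono_set _ hKΩ)).aemeasurable.pow_const β).inv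
      |>.aestronglyMeasurable
  have := (hf.mono_set hKΩ).bdd_mul (c := (c ^ β)⁻¹) hm (by
    filter_upwards [hcu] with x hx
    have h1 : c ^ β ≤ u x ^ β := Real.rpow_le_rpow hc.le hx hβ
    have h2 : 0 < c ^ β := Real.rpow_pos_of_pos hc _
    rw [norm_inv, Real.norm_of_nonneg (h2.le.trans h1)]
    exact inv_anti₀ h2 h1)
  refine this.congr (ae_of_all _ fun x => ?_)
  simp only [div_eq_inv_mul]

/-- The difference of the sub- and supersolution inequalities, tested with `p (u - v) ζ`. -/
theorem integral_comp_sub_test_le (hΩ : IsOpen Ω) (hβ : 0 ≤ β) (hf : IntegrableOn f Ω)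
    (hf0 : ∀ᵐ x ∂volume.restrict Ω, 0 ≤ f x)
    (hupos : LocallyEssPos Ω u) (hu : IsH1locWithGradient Ω u G)
    (hsub : ∀ φ : EuclideanSpace ℝ (Fin n) → ℝ, IsTestFunction 1 Ω φ → (∀ x, 0 ≤ φ x) →
      ∫ x in Ω, inner ℝ (G x) (gradient φ x) ≤ ∫ x in Ω, f x / (u x) ^ β * φ x)
    (hvpos : LocallyEssPos Ω v) (hv : IsH1locWithGradient Ω v H)
    (hsup : ∀ φ : EuclideanSpace ℝ (Fin n) → ℝ, IsTestFunction 1 Ω φ → (∀ x, 0 ≤ φ x) →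
      ∫ x in Ω, f x / (v x) ^ β * φ x ≤ ∫ x in Ω, inner ℝ (H x) (gradient φ x))
    {p : ℝ → ℝ} {C : ℝ} (hp : ContDiff ℝ 1 p) (hp0 : ∀ t, 0 ≤ p t) (hpC : ∀ t, |p t| ≤ C)
    (hpC' : ∀ t, |deriv p t| ≤ C) (hpneg : ∀ t ≤ 0, p t = 0)
    {ζ : EuclideanSpace ℝ (Fin n) → ℝ} (hζ : IsTestFunction 1 Ω ζ) (hζ0 : ∀ x, 0 ≤ ζ x) :
    (∫ x in Ω, (ζ x * deriv p (u x - v x)) * inner ℝ (G x - H x) (G x - H x)) +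
      ∫ x in Ω, p (u x - v x) * inner ℝ (G x - H x) (gradient ζ x) ≤ 0 := by
  set K := tsupport ζ with hK
  have hKc : IsCompact K := hζ.2.1
  have hKΩ : K ⊆ Ω := hζ.2.2
  have hfin : IsFiniteMeasure (volume.restrict K) := isFiniteMeasure_restrict.2 hKc.measure_lt_top.ne
  have hs := hu.sub hv
  obtain ⟨w, hws, hwae, hwG, -⟩ := hs.exists_smooth_approx hΩ hKc hKΩ
  have hw1 : ∀ k, ContDiff ℝ 1 (w k) := fun k => (hws k).of_le (by exact_mod_cast le_top)
  obtain ⟨M, hM0, hM⟩ := hζ.exists_bound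
  have hp' : Continuous (deriv p) := hp.continuous_deriv le_rfl
  have hC0 : 0 ≤ C := (abs_nonneg _).trans (hpC 0)
  have hGK : MemLp G 2 (volume.restrict K) := hu.memLp_restrict hKc hKΩ
  have hHK : MemLp H 2 (volume.restrict K) := hv.memLp_restrict hKc hKΩ
  have hsK : MemLp (fun x => G x - H x) 2 (volume.restrict K) := hGK.sub hHK
  have hζz : ∀ x, x ∉ K → ζ x = 0 := fun x hx => image_eq_zero_of_notMem_tsupport hx
  have hζgz : ∀ x, x ∉ K → gradient ζ x = 0 := fun x hx => gradient_eq_zero_of_notMem_tsupport hx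
  have hζgL := hζ.memLp_gradient K
  have hfu := hupos.integrableOn_div_rpow hu.1.1.aestronglyMeasurable hβ hf hKc hKΩ
  have hfv := hvpos.integrableOn_div_rpow hv.1.1.aestronglyMeasurable hβ hf hKc hKΩ
  have hb1m : ∀ k, Continuous fun x => ζ x * deriv p (w k x) := fun k =>
    hζ.1.continuous.mul (hp'.comp (hws k).continuous)
  have hb1 : ∀ k, ∀ᵐ x ∂volume.restrict K, |ζ x * deriv p (w k x)| ≤ M * C := fun k =>
    ae_of_all _ fun x => by
      rw [abs_mul]; exact mul_le_mul (hM x) (hpC' _) (abs_nonneg _) hM0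
  have hb2m : ∀ k, Continuous fun x => p (w k x) := fun k =>
    hp.continuous.comp (hws k).continuous
  have hwgL : ∀ k, MemLp (gradient (w k)) 2 (volume.restrict K) := fun k =>
    memLp_of_continuous_isCompact hKc (continuous_gradient (hw1 k))
  have hineq : ∀ k, (∫ x in K, (ζ x * deriv p (w k x)) * inner ℝ (G x - H x) (gradient (w k) x)) +
      (∫ x in K, p (w k x) * inner ℝ (G x - H x) (gradient ζ x)) ≤
      ∫ x in K, (f x / u x ^ β - f x / v x ^ β) * (p (w k x) * ζ x) := by
    intro k
    -- As `p (u - v) ζ` need not be `C^1`, the approximation `w k` of `u - v` is used and the limit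
    -- is taken in all three integrals.
    set ψ : EuclideanSpace ℝ (Fin n) → ℝ := fun x => p (w k x) * ζ x with hψ
    have hψsupp : tsupport ψ ⊆ K := closure_mono fun x hx => by
      contrapose! hx
      simp [hψ, Function.notMem_support.1 hx]
    have hψt : IsTestFunction 1 Ω ψ := ⟨(hp.comp (hw1 k)).mul hζ.1,
      hKc.of_isClosed_subset (isClosed_tsupport _) hψsupp, hψsupp.trans hKΩ⟩
    have hψ0 : ∀ x, 0 ≤ ψ x := fun x => mul_nonneg (hp0 _) (hζ0 x)
    have hψz : ∀ x, x ∉ K → ψ x = 0 := fun x hx => by simp [hψ, hζz x hx]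
    have hψgz : ∀ x, x ∉ K → gradient ψ x = 0 := fun x hx =>
      gradient_eq_zero_of_notMem_tsupport fun h => hx (hψsupp h)
    have h1 := hsub ψ hψt hψ0
    have h2 := hsup ψ hψt hψ0
    rw [setIntegral_eq_tsupport hζ fun x hx => by rw [hψgz x hx, inner_zero_right],
      setIntegral_eq_tsupport hζ fun x hx => by rw [hψz x hx, mul_zero]] at h1
    rw [setIntegral_eq_tsupport hζ fun x hx => by rw [hψz x hx, mul_zero],
      setIntegral_eq_tsupport hζ fun x hx => by rw [hψgz x hx, inner_zero_right]] at h2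
    have hψgL := hψt.memLp_gradient K
    obtain ⟨N, -, hN⟩ := hψt.exists_bound
    have hψm : AEStronglyMeasurable ψ (volume.restrict K) := hψt.1.continuous.aestronglyMeasurable
    have hi1 : Integrable (fun x => f x / u x ^ β * ψ x) (volume.restrict K) :=
      hfu.mul_bdd (c := N) hψm (ae_of_all _ hN)
    have hi2 : Integrable (fun x => f x / v x ^ β * ψ x) (volume.restrict K) :=
      hfv.mul_bdd (c := N) hψm (ae_of_all _ hN)
    simp only [sub_mul]
    rw [integral_sub hi1 hi2, ← integral_add (integrable_mul_inner
      (hb1m k).aestronglyMeasurable (hb1 k) hsK (hwgL k)) (integrable_mul_inner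
      (hb2m k).aestronglyMeasurable (ae_of_all _ fun x => hpC _) hsK hζgL)]
    have e : ∀ x, (ζ x * deriv p (w k x)) * inner ℝ (G x - H x) (gradient (w k) x) +
        p (w k x) * inner ℝ (G x - H x) (gradient ζ x) =
        inner ℝ (G x) (gradient ψ x) - inner ℝ (H x) (gradient ψ x) := by
      intro x
      have hdw := (hw1 k).differentiable one_ne_zero x
      have hdp := hp.differentiable one_ne_zero (w k x)
      rw [← inner_sub_left, hψ, gradient_mul (a := fun y => p (w k y))
        (hdp.comp x hdw) (hζ.1.differentiable one_ne_zero x), gradient_comp_real hdp.hasDerivAt hdw]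
      simp only [inner_add_right, inner_smul_right]
      ring
    simp only [e]
    rw [integral_sub (integrable_inner_of_memLp hGK hψgL) (integrable_inner_of_memLp hHK hψgL)]
    linarith
  have hlim1 := tendsto_integral_mul_inner (μ := volume.restrict K)
    (b₀ := fun x => ζ x * deriv p (u x - v x)) (fun k => (hb1m k).aestronglyMeasurable) hb1
    (by filter_upwards [hwae] with x hx using ((hp'.tendsto _).comp hx).const_mul _)
    hsK hwgL hsK hwG
  have hlim2 := tendsto_integral_mul_inner (μ := volume.restrict K)
    (b₀ := fun x => p (u x - v x)) (Y := fun _ => gradient ζ) (Y₀ := gradient ζ)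
    (fun k => (hb2m k).aestronglyMeasurable) (fun k => ae_of_all _ fun x => hpC _)
    (by filter_upwards [hwae] with x hx using (hp.continuous.tendsto _).comp hx)
    hsK (fun _ => hζgL) hζgL (by simp)
  have hlim3 : Tendsto (fun k => ∫ x in K, (f x / u x ^ β - f x / v x ^ β) * (p (w k x) * ζ x))
      atTop (𝓝 (∫ x in K, (f x / u x ^ β - f x / v x ^ β) * (p (u x - v x) * ζ x))) := by
    have hD : Integrable (fun x => f x / u x ^ β - f x / v x ^ β) (volume.restrict K) :=
      hfu.sub hfv
    refine tendsto_integral_of_dominated_convergence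
      (fun x => ‖f x / u x ^ β - f x / v x ^ β‖ * (C * M)) (fun k => hD.1.mul
        ((hb2m k).mul hζ.1.continuous).aestronglyMeasurable) (hD.norm.mul_const _)
      (fun k => ae_of_all _ fun x => ?_) ?_
    · rw [norm_mul]
      refine mul_le_mul_of_nonneg_left ?_ (norm_nonneg _)
      rw [norm_mul]
      exact mul_le_mul (hpC _) (hM x) (abs_nonneg _) hC0
    · filter_upwards [hwae] with x hx
      exact (((hp.continuous.tendsto _).comp hx).mul_const _).const_mul _
  have hlim := le_of_tendsto_of_tendsto' (hlim1.add hlim2) hlim3 hineq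
  rw [setIntegral_eq_tsupport hζ fun x hx => by rw [hζz x hx, zero_mul, zero_mul],
    setIntegral_eq_tsupport hζ fun x hx => by rw [hζgz x hx, inner_zero_right, mul_zero]]
  refine hlim.trans (integral_nonpos_of_ae ?_)
  obtain ⟨c, hc, hcv⟩ := hvpos K hKc hKΩ
  filter_upwards [hcv, ae_restrict_of_ae_restrict_of_subset hKΩ hf0] with x hvx hfx
  -- Sign of the right-hand side: `p` vanishes where `u ≤ v`, and elsewhere monotonicity of the
  -- power makes the difference of the singular terms nonpositive.
  rcases le_total (u x - v x) 0 with hux | hux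
  · simp [hpneg _ hux]
  · refine mul_nonpos_of_nonpos_of_nonneg ?_ (mul_nonneg (hp0 _) (hζ0 x))
    have hv0 : 0 < v x := hc.trans_le hvx
    rw [sub_nonpos]
    exact div_le_div_of_nonneg_left hfx (Real.rpow_pos_of_pos hv0 _)
      (Real.rpow_le_rpow hv0.le (sub_nonneg.1 hux) hβ)

end Testing

/-! ### The comparison argument. -/

section Comparison

variable {n : ℕ} {Ω : Set (EuclideanSpace ℝ (Fin n))} {β : ℝ}
  {u v f : EuclideanSpace ℝ (Fin n) → ℝ}
  {G H : EuclideanSpace ℝ (Fin n) → EuclideanSpace ℝ (Fin n)}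

/-- A subsequence of the `H^1` approximation converges almost everywhere, which both Fatou's lemma
and the cutoff construction need. -/
theorem MemH10.exists_tendsto_ae {z : EuclideanSpace ℝ (Fin n) → ℝ} (h : MemH10 Ω z) :
    ∃ Z : EuclideanSpace ℝ (Fin n) → EuclideanSpace ℝ (Fin n),
      IsH1locWithGradient Ω z Z ∧ MemLp Z 2 (volume.restrict Ω) ∧
      ∃ φ : ℕ → EuclideanSpace ℝ (Fin n) → ℝ, (∀ m, IsTestFunction ∞ Ω (φ m)) ∧
        (∀ᵐ x ∂volume.restrict Ω, Tendsto (fun m => φ m x) atTop (𝓝 (z x))) ∧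
        Tendsto (fun m => eLpNorm (fun x => gradient (φ m) x - Z x) 2 (volume.restrict Ω))
          atTop (𝓝 0) := by
  obtain ⟨Z, hZ, hz2, hZ2, φ, hφ, hφz, hφZ⟩ := h
  obtain ⟨ns, hns, hae⟩ := (tendstoInMeasure_of_tendsto_eLpNorm (p := 2) (by norm_num)
    (fun m => (hφ m).1.continuous.aestronglyMeasurable) hz2.1 hφz).exists_seq_tendsto_ae
  exact ⟨Z, ⟨hZ, fun K _ hKΩ => ⟨hz2.mono_measure (Measure.restrict_mono_set _ hKΩ),
    hZ2.mono_measure (Measure.restrict_mono_set _ hKΩ)⟩⟩, hZ2, φ ∘ ns, fun m => hφ _, hae,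
    hφZ.comp hns.tendsto_atTop⟩

/-- The Caccioppoli inequality for functions in `H^1_0(Ω)`. -/
theorem memLp_div_smul_of_superharmonic (hΩ : IsOpen Ω) (hpos : LocallyEssPos Ω v)
    (hv : IsH1locWithGradient Ω v G)
    (hsup : ∀ φ : EuclideanSpace ℝ (Fin n) → ℝ, IsTestFunction 1 Ω φ → (∀ x, 0 ≤ φ x) →
      0 ≤ ∫ x in Ω, inner ℝ (G x) (gradient φ x))
    {z : EuclideanSpace ℝ (Fin n) → ℝ} (hz : MemH10 Ω z) :
    MemLp (fun x => (z x / v x) • G x) 2 (volume.restrict Ω) := by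
  obtain ⟨Z, hzZ, hZ2, φ, hφ, hφz, hφZ⟩ := hz.exists_tendsto_ae
  have hφ1 : ∀ m, IsTestFunction 1 Ω (φ m) := fun m => (hφ m).mono (by exact_mod_cast le_top)
  have hvm := hv.1.1.aestronglyMeasurable
  have hGm := hv.1.2.1.aestronglyMeasurable
  have hm : ∀ {w : EuclideanSpace ℝ (Fin n) → ℝ}, AEStronglyMeasurable w (volume.restrict Ω) →
      AEStronglyMeasurable (fun x => (w x / v x) • G x) (volume.restrict Ω) := fun hw =>
    (hw.aemeasurable.div hvm.aemeasurable).aestronglyMeasurable.smul hGm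
  refine ⟨hm hzZ.1.1.aestronglyMeasurable, ?_⟩
  have hfatou := Lp.eLpNorm_lim_le_liminf_eLpNorm (p := 2) (μ := volume.restrict Ω)
    (f := fun m x => (φ m x / v x) • G x)
    (fun m => hm (hφ m).1.continuous.aestronglyMeasurable) (fun x => (z x / v x) • G x)
    (by filter_upwards [hφz] with x hx using (hx.div_const _).smul_const _)
  -- Eventually `‖∇φ_m - Z‖ ≤ 1` in `L²`, which gives this bound through the inequality for test
  -- functions.
  refine (hfatou.trans (liminf_le_of_frequently_le' (x := 2 * (1 + eLpNorm Z 2 (volume.restrict Ω)))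
    (Eventually.frequently ?_))).trans_lt
    (ENNReal.mul_lt_top (by simp) (ENNReal.add_lt_top.2 ⟨by simp, hZ2.2⟩))
  filter_upwards [hφZ.eventually_le_const one_pos] with m hm1
  refine (eLpNorm_div_smul_le_of_superharmonic hΩ hpos hv hsup (hφ1 m)).trans ?_
  gcongr
  calc eLpNorm (gradient (φ m)) 2 (volume.restrict Ω)
      = eLpNorm ((fun x => gradient (φ m) x - Z x) + Z) 2 (volume.restrict Ω) := by
        congr 1; funext x; simp
    _ ≤ _ := (eLpNorm_add_le (((hφ1 m).memLp_gradient Ω).sub hZ2).1 hZ2.1 (by norm_num)).trans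
        (add_le_add_left hm1 _)

/-- The core of the comparison principle: `u - v ≤ 2ε`. -/
theorem ae_sub_le_two_mul (hn : 1 ≤ n) (hΩ : IsOpen Ω) (hΩb : Bornology.IsBounded Ω)
    (hβ : 0 ≤ β) (hf : IntegrableOn f Ω) (hf0 : ∀ᵐ x ∂volume.restrict Ω, 0 ≤ f x)
    (hu : IsSubsolution Ω β f u) (hv : IsSupersolution Ω β f v) {ε : ℝ} (hε : 0 < ε)
    (hz : MemH10 Ω (fun x => max (u x - ε) 0)) :
    ∀ᵐ x ∂volume.restrict Ω, u x - v x ≤ 2 * ε := by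
  obtain ⟨hupos, G, hG, hsub⟩ := hu
  obtain ⟨hvpos, H, hH, hsup⟩ := hv
  have hΩm := hΩ.measurableSet
  have hfin : IsFiniteMeasure (volume.restrict Ω) :=
    isFiniteMeasure_restrict.2 hΩb.measure_lt_top.ne
  have hv0 := hvpos.ae_pos hΩ
  have hsuper : ∀ φ : EuclideanSpace ℝ (Fin n) → ℝ, IsTestFunction 1 Ω φ → (∀ x, 0 ≤ φ x) →
      0 ≤ ∫ x in Ω, inner ℝ (H x) (gradient φ x) := fun φ hφ hφ0 => by
    refine le_trans (integral_nonneg_of_ae ?_) (hsup φ hφ hφ0)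
    filter_upwards [hf0, hv0] with x hfx hvx
    exact mul_nonneg (div_nonneg hfx (Real.rpow_nonneg hvx.le _)) (hφ0 x)
  have hHz := memLp_div_smul_of_superharmonic hΩ hvpos hH hsuper hz
  obtain ⟨Z, hzZ, hZ2, φ, hφ, hφz, hφZ⟩ := hz.exists_tendsto_ae
  have hφ1 : ∀ m, IsTestFunction 1 Ω (φ m) := fun m => (hφ m).mono (by exact_mod_cast le_top)
  have hZG := hG.ae_eq_of_posPart hΩ hzZ
  have hs := hG.sub hH
  have hsm : AEStronglyMeasurable (fun x => u x - v x) (volume.restrict Ω) :=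
    hs.1.1.aestronglyMeasurable
  -- the gradient of `u - v` is square integrable on `{u - v > 2ε}`
  set S : Set (EuclideanSpace ℝ (Fin n)) := {x | 2 * ε < u x - v x} with hS
  set F := S.indicator fun x => G x - H x with hF
  have hF2 : MemLp F 2 (volume.restrict Ω) := by
    refine MemLp.mono' (hZ2.norm.add hHz.norm) (hs.1.2.1.aestronglyMeasurable.indicator₀
      (nullMeasurableSet_lt aemeasurable_const hsm.aemeasurable)) ?_
    -- On `S`, `u > 2ε` gives `∇u = Z`, and `u - ε > v` gives `z / v ≥ 1`; hence `|F| ≤ |Z| + |(z /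
    -- v) H|`.
    filter_upwards [hZG, hv0] with x hx hvx
    by_cases hxS : x ∈ S
    · have hxS' : 2 * ε < u x - v x := hxS
      rw [hF, Set.indicator_of_mem hxS, ← hx (by linarith)]
      refine (norm_sub_le _ _).trans (add_le_add_right ?_ _)
      beta_reduce
      rw [norm_smul]
      refine le_mul_of_one_le_left (norm_nonneg _) ((le_abs_self _).trans' ?_)
      rw [one_le_div hvx]
      exact (by linarith : v x ≤ u x - ε).trans (le_max_left _ _)
    · rw [hF, Set.indicator_of_notMem hxS, norm_zero]
      exact add_nonneg (norm_nonneg _) (norm_nonneg _)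
  obtain ⟨p, hps, hpmono, hp0, hp1, ⟨C, hC0, hpC⟩, hplo, hppos, -⟩ :=
    exists_smooth_step (lt_add_one (2 * ε))
  -- The lower threshold is positive, so `q 0 = 0` and `q (φ_m)` keeps compact support; the upper
  -- one is `ε` because `(u - ε)⁺ > ε` on `S`.
  obtain ⟨q, hqs, -, hq0, hq1, ⟨D, hD0, hqD⟩, hqlo, -, hqhi⟩ := exists_smooth_step (half_lt_self hε)
  have hps1 : ContDiff ℝ 1 p := hps.of_le (by exact_mod_cast le_top)
  have hqs1 : ContDiff ℝ 1 q := hqs.of_le (by exact_mod_cast le_top)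
  have hp' : Continuous (deriv p) := hps1.continuous_deriv le_rfl
  have hq' : Continuous (deriv q) := hqs1.continuous_deriv le_rfl
  have hpm := hps.continuous.comp_aestronglyMeasurable hsm
  have hpm' := hp'.comp_aestronglyMeasurable hsm
  set ζ : ℕ → EuclideanSpace ℝ (Fin n) → ℝ := fun m x => q (φ m x) with hζ
  have hζt : ∀ m, IsTestFunction 1 Ω (ζ m) := fun m => by
    have hsupp : tsupport (ζ m) ⊆ tsupport (φ m) := closure_mono fun x hx => by
      contrapose! hx
      simp [hζ, Function.notMem_support.1 hx, (hqlo 0 (by linarith)).1]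
    exact ⟨hqs1.comp (hφ1 m).1, (hφ m).2.1.of_isClosed_subset (isClosed_tsupport _) hsupp,
      hsupp.trans (hφ m).2.2⟩
  have hζg : ∀ m x, gradient (ζ m) x = deriv q (φ m x) • gradient (φ m) x := fun m x =>
    gradient_comp_real (hqs1.differentiable one_ne_zero _).hasDerivAt
      ((hφ1 m).1.differentiable one_ne_zero x)
  have hζm : ∀ m, AEStronglyMeasurable (ζ m) (volume.restrict Ω) := fun m =>
    (hζt m).1.continuous.aestronglyMeasurable
  have hqm : ∀ m, AEStronglyMeasurable (fun x => deriv q (φ m x)) (volume.restrict Ω) := fun m =>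
    (hq'.comp (hφ m).1.continuous).aestronglyMeasurable
  have hφgL : ∀ m, MemLp (gradient (φ m)) 2 (volume.restrict Ω) := fun m =>
    (hφ1 m).memLp_gradient Ω
  -- on `{u - v > 2ε}` the cutoffs are eventually constant
  have hev : ∀ᵐ x ∂volume.restrict Ω, x ∈ S → ∀ᶠ m in atTop, ζ m x = 1 ∧ deriv q (φ m x) = 0 := by
    filter_upwards [hφz, hv0] with x hx hvx hxS
    have hxS' : 2 * ε < u x - v x := hxS
    have hlt : ε < max (u x - ε) 0 := lt_max_of_lt_left (by linarith)
    filter_upwards [hx.eventually_const_lt hlt] with m hm using hqhi _ hm.le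
  have hoff : ∀ x, x ∉ S → p (u x - v x) = 0 ∧ deriv p (u x - v x) = 0 := fun x hx =>
    hplo _ (not_lt.1 hx)
  -- the gradient of `p (u - v)` vanishes
  have hineq : ∀ m, (∫ x in Ω, (ζ m x * deriv p (u x - v x)) * inner ℝ (F x) (F x)) +
      ∫ x in Ω, (p (u x - v x) * deriv q (φ m x)) * inner ℝ (F x) (gradient (φ m) x) ≤ 0 := by
    intro m
    refine le_of_eq_of_le ?_ (integral_comp_sub_test_le (C := max C 1) hΩ hβ hf hf0 hupos hG hsub
      hvpos hH hsup hps1 hp0 (fun t => (hp1 t).trans (le_max_right _ _))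
      (fun t => (hpC t).trans (le_max_left _ _)) (fun t ht => (hplo t (by linarith)).1) (hζt m)
      (fun x => hq0 _))
    congr 1 <;> refine integral_congr_ae (ae_of_all _ fun x => ?_) <;> by_cases hxS : x ∈ S
    · simp only [hF, Set.indicator_of_mem hxS]
    · simp only [(hoff x hxS).2, mul_zero, zero_mul]
    · simp only [hF, Set.indicator_of_mem hxS, hζg, inner_smul_right, mul_assoc]
    · simp only [(hoff x hxS).1, zero_mul]
  have hlim1 := tendsto_integral_mul_inner (μ := volume.restrict Ω) (C := 1 * C)
    (b := fun m x => ζ m x * deriv p (u x - v x)) (b₀ := fun x => deriv p (u x - v x))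
    (X := F) (Y := fun _ => F) (Y₀ := F) (fun m => (hζm m).mul hpm')
    (fun m => ae_of_all _ fun x => by
      rw [abs_mul]; exact mul_le_mul (hq1 _) (hpC _) (abs_nonneg _) zero_le_one)
    (by
      filter_upwards [hev] with x hx
      by_cases hxS : x ∈ S
      · refine tendsto_const_nhds.congr' ?_
        filter_upwards [hx hxS] with m hm
        rw [hm.1, one_mul]
      · simp [(hoff x hxS).2])
    hF2 (fun _ => hF2) hF2 (by simp)
  -- The cutoff error vanishes: its coefficient tends to zero almost everywhere, while `F` is in
  -- `L²` and `∇φ_m` converges in `L²`.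
  have hlim2 := tendsto_integral_mul_inner (μ := volume.restrict Ω) (C := 1 * D)
    (b := fun m x => p (u x - v x) * deriv q (φ m x)) (b₀ := fun _ => 0)
    (X := F) (Y := fun m => gradient (φ m)) (Y₀ := Z) (fun m => hpm.mul (hqm m))
    (fun m => ae_of_all _ fun x => by
      rw [abs_mul]; exact mul_le_mul (hp1 _) (hqD _) (abs_nonneg _) zero_le_one)
    (by
      filter_upwards [hev] with x hx
      by_cases hxS : x ∈ S
      · refine tendsto_const_nhds.congr' ?_
        filter_upwards [hx hxS] with m hm
        rw [hm.2, mul_zero]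
      · simp [(hoff x hxS).1])
    hF2 hφgL hZ2 hφZ
  have hle := le_of_tendsto' (hlim1.add hlim2) hineq
  simp only [zero_mul, integral_zero, add_zero] at hle
  have hnn : ∀ x, 0 ≤ deriv p (u x - v x) * inner ℝ (F x) (F x) := fun x =>
    mul_nonneg hpmono.deriv_nonneg real_inner_self_nonneg
  have hzero := (integral_eq_zero_iff_of_nonneg hnn (integrable_mul_inner hpm'
    (ae_of_all _ fun x => hpC _) hF2 hF2)).1 (le_antisymm hle (integral_nonneg hnn))
  have hgrad : ∀ᵐ x ∂volume.restrict Ω, deriv p (u x - v x) = 0 ∨ G x - H x = 0 := by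
    filter_upwards [hzero] with x hx
    by_cases hxS : x ∈ S
    · refine (mul_eq_zero.1 hx).imp_right fun h => ?_
      simpa only [hF, Set.indicator_of_mem hxS, inner_self_eq_zero] using h
    · exact Or.inl (hoff x hxS).2
  -- test the weak gradient of `p (u - v)` with a truncated coordinate
  set e : EuclideanSpace ℝ (Fin n) := EuclideanSpace.single ⟨0, hn⟩ 1 with he
  have hee : inner ℝ e e = (1 : ℝ) := by rw [real_inner_self_eq_norm_sq]; simp [he]
  have hlin : ContDiff ℝ 1 fun x : EuclideanSpace ℝ (Fin n) => inner ℝ e x :=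
    contDiff_const.inner ℝ contDiff_id
  have hling : ∀ x, gradient (fun x : EuclideanSpace ℝ (Fin n) => inner ℝ e x) x = e := fun x =>
    HasGradientAt.gradient ((InnerProductSpace.toDual ℝ _ e).hasFDerivAt)
  obtain ⟨R, hR⟩ := hΩb.exists_norm_le
  have hlinR : ∀ᵐ x ∂volume.restrict Ω, |inner ℝ e x| ≤ R := by
    filter_upwards [ae_restrict_mem hΩm] with x hx
    refine (abs_real_inner_le_norm e x).trans ?_
    simpa [he] using hR x hx
  have hb3m : ∀ m, AEStronglyMeasurable (fun x => ζ m x * p (u x - v x)) (volume.restrict Ω) :=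
    fun m => (hζm m).mul hpm
  have hb3 : ∀ m, ∀ᵐ x ∂volume.restrict Ω, |ζ m x * p (u x - v x)| ≤ 1 * 1 := fun m =>
    ae_of_all _ fun x => by
      rw [abs_mul]; exact mul_le_mul (hq1 _) (hp1 _) (abs_nonneg _) zero_le_one
  have hb4m : ∀ m, AEStronglyMeasurable
      (fun x => p (u x - v x) * (inner ℝ e x * deriv q (φ m x))) (volume.restrict Ω) := fun m =>
    hpm.mul (hlin.continuous.aestronglyMeasurable.mul (hqm m))
  have hb4 : ∀ m, ∀ᵐ x ∂volume.restrict Ω,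
      |p (u x - v x) * (inner ℝ e x * deriv q (φ m x))| ≤ 1 * (R * D) := fun m => by
    filter_upwards [hlinR] with x hx
    rw [abs_mul, abs_mul]
    exact mul_le_mul (hp1 _) (mul_le_mul hx (hqD _) (abs_nonneg _) ((abs_nonneg _).trans hx))
      (by positivity) zero_le_one
  -- This expands `∫ p (u - v) ⟪e, ∇(⟪e, x⟫ ζ_m)⟫ = 0`. The coordinate has gradient `e`, so the
  -- first term tends to `∫ p (u - v)`; the second is a cutoff error, controlled because the
  -- coordinate is bounded on `Ω`.
  have hid : ∀ m, (∫ x in Ω, (ζ m x * p (u x - v x)) * inner ℝ e e) +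
      ∫ x in Ω, (p (u x - v x) * (inner ℝ e x * deriv q (φ m x))) *
        inner ℝ e (gradient (φ m) x) = 0 := by
    intro m
    have hηt : IsTestFunction 1 Ω fun x => inner ℝ e x * ζ m x :=
      ⟨hlin.mul (hζt m).1, (hζt m).2.1.mul_left,
        (closure_mono fun x hx => by
          contrapose! hx
          simp [Function.notMem_support.1 hx] :
          tsupport (fun x => inner ℝ e x * ζ m x) ⊆ tsupport (ζ m)).trans (hζt m).2.2⟩
    have hchain := hs.integral_comp_mul_inner_gradient hΩ (C := max C 1) hps1
      (fun t => (hp1 t).trans (le_max_right _ _)) (fun t => (hpC t).trans (le_max_left _ _)) hηt e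
    have hr : ∫ x in Ω, ((inner ℝ e x * ζ m x) * deriv p (u x - v x)) *
        inner ℝ e (G x - H x) = 0 := by
      refine integral_eq_zero_of_ae ?_
      filter_upwards [hgrad] with x hx
      rcases hx with hx | hx <;> simp [hx]
    rw [hr, neg_zero] at hchain
    rw [← hchain, ← integral_add
      (integrable_mul_inner (hb3m m) (hb3 m) (memLp_const e) (memLp_const e))
      (integrable_mul_inner (hb4m m) (hb4 m) (memLp_const e) (hφgL m))]
    refine integral_congr_ae (ae_of_all _ fun x => ?_)
    simp only
    rw [gradient_mul (hlin.differentiable one_ne_zero x)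
      ((hζt m).1.differentiable one_ne_zero x), hling, hζg]
    simp only [inner_add_right, inner_smul_right]
    ring
  have hlim3 := tendsto_integral_mul_inner (μ := volume.restrict Ω) (C := 1 * 1)
    (b := fun m x => ζ m x * p (u x - v x)) (b₀ := fun x => p (u x - v x))
    (X := fun _ => e) (Y := fun _ _ => e) (Y₀ := fun _ => e) hb3m hb3
    (by
      filter_upwards [hev] with x hx
      by_cases hxS : x ∈ S
      · refine tendsto_const_nhds.congr' ?_
        filter_upwards [hx hxS] with m hm
        rw [hm.1, one_mul]
      · simp [(hoff x hxS).1])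
    (memLp_const e) (fun _ => memLp_const e) (memLp_const e) (by simp)
  have hlim4 := tendsto_integral_mul_inner (μ := volume.restrict Ω) (C := 1 * (R * D))
    (b := fun m x => p (u x - v x) * (inner ℝ e x * deriv q (φ m x))) (b₀ := fun _ => 0)
    (X := fun _ => e) (Y := fun m => gradient (φ m)) (Y₀ := Z)
    hb4m hb4
    (by
      filter_upwards [hev] with x hx
      by_cases hxS : x ∈ S
      · refine tendsto_const_nhds.congr' ?_
        filter_upwards [hx hxS] with m hm
        rw [hm.2, mul_zero, mul_zero]
      · simp [(hoff x hxS).1])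
    (memLp_const e) hφgL hZ2 hφZ
  have heq := tendsto_nhds_unique (hlim3.add hlim4) (tendsto_const_nhds.congr fun m => (hid m).symm)
  simp only [zero_mul, integral_zero, add_zero, hee, mul_one] at heq
  have hpi : Integrable (fun x => p (u x - v x)) (volume.restrict Ω) :=
    Integrable.of_bound hpm 1 (ae_of_all _ fun x => hp1 _)
  filter_upwards [(integral_eq_zero_iff_of_nonneg (fun x => hp0 _) hpi).1 heq] with x hx
  by_contra hlt
  exact (hppos _ (not_le.1 hlt)).ne' hx

end Comparison

end SingularElliptic

theorem theorem2p2 (n : ℕ) (hn : 1 ≤ n)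
    (Ω : Set (EuclideanSpace ℝ (Fin n))) (hΩ : IsOpen Ω) (hΩb : Bornology.IsBounded Ω)
    (β : ℝ) (hβ : 1 < β)
    (f : EuclideanSpace ℝ (Fin n) → ℝ) (hf : IntegrableOn f Ω volume)
    (hf0 : ∀ᵐ x ∂(volume.restrict Ω), 0 ≤ f x)
    (u v : EuclideanSpace ℝ (Fin n) → ℝ)
    (hu : SingularElliptic.IsSubsolution Ω β f u)
    (hu0 : SingularElliptic.NonposOnBoundary Ω u)
    (hv : SingularElliptic.IsSupersolution Ω β f v) :
    ∀ᵐ x ∂(volume.restrict Ω), u x ≤ v x := by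
  have hk : ∀ k : ℕ, (0 : ℝ) < 1 / ((k : ℝ) + 1) := fun k => Nat.one_div_pos_of_nat
  -- Taking `ε = 1 / (k + 1)` leaves countably many exceptional null sets.
  have h := ae_all_iff.2 fun k : ℕ => SingularElliptic.ae_sub_le_two_mul hn hΩ hΩb
    (zero_le_one.trans hβ.le) hf hf0 hu hv (hk k) (hu0 _ (hk k))
  filter_upwards [h] with x hx
  have hlim := (tendsto_one_div_add_atTop_nhds_zero_nat (𝕜 := ℝ)).const_mul 2
  rw [mul_zero] at hlim
  exact sub_nonpos.1 (ge_of_tendsto' hlim hx)
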